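/- Let $V$ be a complex vector space of dimension $g$ (for instance $V=\mathbb C^g$) with a positive definite hermitian form $H$, linear in the first argument, let $E=\operatorname{Im}H$ and let $\nu>0$. Let $\Gamma_r=\mathbb Z\omega_1+\cdots+\mathbb Z\omega_r$ be a discrete subgroup of $(V,+)$ of rank $r$, with $\mathbb Z$-basis $\omega_1,\dots,\omega_r$, which is isotropic, i.e. $E(\gamma,\gamma')=0$ for all $\gamma,\gamma'\in\Gamma_r$ (this forces $0\le r\le g$ and makes $\omega_1,\dots,\omega_r$ linearly independent over $\mathbb C$). Let $\omega_{r+1},\dots,\omega_g$ be an $H$-orthonormal basis of the $H$-orthogonal complement of $\operatorname{Span}_{\mathbb C}(\Gamma_r)$. Write $u=\sum_{j=1}^g z_j\omega_j\in V$ as $u=(z,z_\perp)$ with $z=(z_1,\dots,z_r)\in\mathbb C^r$ and $z_\perp=(z_{r+1},\dots,z_g)\in\mathbb C^{g-r}$, and let $\lambda$ be the Lebesgue measure of these coordinates, $d\lambda(u)=d\lambda(z)\,d\lambda(z_\perp)$ on $\mathbb C^r\times\mathbb C^{g-r}$. Let $B=(H(\omega_j,\omega_k))_{1\le j,k\le r}$,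 a real symmetric positive definite matrix, and $B(z,z)=\sum_{j,k}z_jz_kH(\omega_j,\omega_k)$. For $\alpha\in\mathbb R^r$ let $\chi_\alpha$ be the character $\chi_\alpha(\sum_j m_j\omega_j)=e^{2\pi i\sum_j\alpha_jm_j}$ of $\Gamma_r$. Let $\Lambda$ be any fundamental domain of $\Gamma_r$ acting on $V$ by translations (up to $\lambda$-null sets; for instance $([0,1]\times\mathbb R)^r\times\mathbb C^{g-r}$ in the coordinates above), and put $$\langle f,h\rangle=\int_{\Lambda}f(u)\overline{h(u)}\,e^{-\nu H(u,u)}\,d\lambda(u),\qquad \|f\|^2=\int_{\Lambda}|f(u)|^2e^{-\nu H(u,u)}\,d\lambda(u).$$ The theta Fock–Bargmann space $\mathcal F=\mathcal F^{2,\nu,H}_{\Gamma_r,\chi_\alpha}(V)$ is the space of all holomorphic functions $f$ on $V$ such that $f(u+\gamma)=\chi_\alpha(\gamma)\,e^{\nu H(u+\gamma/2,\gamma)}f(u)$ for all $u\in V$, $\gamma\in\Gamma_r$, and $\|f\|^2<\infty$. For $n\in\mathbb Z^r$ and $k\in\mathbb N^{g-r}$ (with $0\in\mathbb N$), let $$e^{\alpha,\nu}_{n,k}(z,z_\perp)=e^{\frac{\nu}{2}B(z,z)+2\pi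 i\sum_j(\alpha_j+n_j)z_j}\,z_\perp^{k}.$$ Then: 1. The functions $e^{\alpha,\nu}_{n,k}$ form an orthogonal basis of $\mathcal F$: they belong to $\mathcal F$, are non-zero and pairwise orthogonal, and their linear span is dense in $\mathcal F$ for $\|\cdot\|$. Their norms are given by $$\|e^{\alpha,\nu}_{n,k}\|^2=\frac{1}{\sqrt{\det B}}\left(\frac{\pi}{2\nu}\right)^{r/2}\left(\frac{\pi}{\nu}\right)^{g-r}\frac{k!}{\nu^{|k|}}\,e^{\frac{2\pi^2}{\nu}(n+\alpha)B^{-1}(n+\alpha)}.$$ 2. A function $f:V\to\mathbb C$ belongs to $\mathcal F$ if and only if there are complex numbers $(a_{n,k})$ with $f(u)=\sum_{(n,k)\in\mathbb Z^r\times\mathbb N^{g-r}}a_{n,k}\,e^{\alpha,\nu}_{n,k}(u)$ for every $u\in V$ (absolutely convergent) and $$\frac{1}{\sqrt{\det B}}\left(\frac{\pi}{2\nu}\right)^{r/2}\left(\frac{\pi}{\nu}\right)^{g-r}\sum_{(n,k)}\frac{k!}{\nu^{|k|}}\,e^{\frac{2\pi^2}{\nu}(n+\alpha)B^{-1}(n+\alpha)}\,|a_{n,k}|^2<\infty.$$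 Any such expansion also converges (unconditionally) to $f$ locally uniformly on $V$ and in the norm of $\mathcal F$. -/

import Mathlib

open MeasureTheory Module
open scoped ENNReal Matrix ComplexConjugate

namespace ThetaFB

noncomputable section

/-- The positive definite hermitian form `H(u, v)` of a complex inner product space, in the
convention "linear in the first argument, conjugate-linear in the second". -/
def herm {V : Type*} [NormedAddCommGroup V] [InnerProductSpace ℂ V] (u v : V) : ℂ :=
  inner ℂ v u

/-- `Γ` is isotropic for the symplectic form `E = Im H`. -/
def IsIsotropic {V : Type*} [NormedAddCommGroup V] [InnerProductSpace ℂ V]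
    (Γ : AddSubgroup V) : Prop :=
  ∀ u ∈ Γ, ∀ v ∈ Γ, (herm u v).im = 0

/-- The complex span `W_ℂ` of `Γ`. -/
abbrev cspan {V : Type*} [NormedAddCommGroup V] [InnerProductSpace ℂ V]
    (Γ : AddSubgroup V) : Submodule ℂ V :=
  Submodule.span ℂ (Γ : Set V)

/-- The linear parametrization `(z, z_⊥) ↦ ∑ z_j ω_j + ∑ (z_⊥)_l η_l` of `V` attached to a
`ℤ`-basis `ω` of `Γ` and an orthonormal basis `η` of the `H`-orthogonal complement of `W_ℂ`. -/
def param {V : Type*} [NormedAddCommGroup V] [InnerProductSpace ℂ V] {Γ : AddSubgroup V}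
    {r s : ℕ} (ω : Basis (Fin r) ℤ Γ) (η : OrthonormalBasis (Fin s) ℂ (cspan Γ)ᗮ) :
    ((Fin r → ℂ) × (Fin s → ℂ)) →ₗ[ℂ] V :=
  (Fintype.linearCombination ℂ (fun j => (ω j : V))).coprod
    (Fintype.linearCombination ℂ (fun l => (η l : V)))

theorem linearIndependent_real {V : Type*} [NormedAddCommGroup V] [InnerProductSpace ℂ V]
    [FiniteDimensional ℂ V] {Γ : AddSubgroup V} [DiscreteTopology Γ] {r : ℕ}
    (ω : Basis (Fin r) ℤ Γ) : LinearIndependent ℝ (fun j => (ω j : V)) := by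
  have : FiniteDimensional ℝ V := FiniteDimensional.complexToReal V
  have hspan : Submodule.span ℤ (Set.range fun j => (ω j : V)) = AddSubgroup.toIntSubmodule Γ := by
    apply le_antisymm
    · refine Submodule.span_le.2 ?_
      rintro _ ⟨j, rfl⟩
      exact (ω j).2
    · intro γ hγ
      have h := congrArg (Subtype.val) (ω.sum_repr ⟨γ, hγ⟩)
      rw [AddSubgroup.val_finsetSum] at h
      change _ = γ at h
      rw [← h]
      refine Submodule.sum_mem _ fun j _ => ?_
      rw [AddSubgroup.coe_zsmul]
      exact zsmul_mem (Submodule.subset_span (Set.mem_range_self j)) _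
  have hd : DiscreteTopology (Submodule.span ℤ (Set.range fun j => (ω j : V))) := by
    rw [hspan]
    exact inferInstanceAs (DiscreteTopology Γ)
  have hZ : LinearIndependent ℤ (fun j => (ω j : V)) :=
    LinearIndependent.map' ω.linearIndependent (AddSubgroup.toIntSubmodule Γ).subtype
      (Submodule.ker_subtype _)
  rw [linearIndependent_iff_card_eq_finrank_span, Real.finrank_eq_int_finrank_of_discrete hd]
  exact (finrank_span_eq_card hZ).symm

theorem linearIndependent_complex {V : Type*} [NormedAddCommGroup V] [InnerProductSpace ℂ V]
    [FiniteDimensional ℂ V] {Γ : AddSubgroup V} [DiscreteTopology Γ] (hΓ : IsIsotropic Γ) {r : ℕ}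
    (ω : Basis (Fin r) ℤ Γ) : LinearIndependent ℂ (fun j => (ω j : V)) := by
  have hR := linearIndependent_real ω
  have him : ∀ x y : Fin r → ℝ,
      (inner ℂ (∑ j, ((x j : ℝ) : ℂ) • (ω j : V)) (∑ j, ((y j : ℝ) : ℂ) • (ω j : V)) : ℂ).im = 0 := by
    intro x y
    rw [sum_inner, Complex.im_sum]
    refine Finset.sum_eq_zero fun j _ => ?_
    rw [inner_sum, Complex.im_sum]
    refine Finset.sum_eq_zero fun k _ => ?_
    have h : (inner ℂ (ω j : V) (ω k : V) : ℂ).im = 0 := hΓ _ (ω k).2 _ (ω j).2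
    rw [inner_smul_left, inner_smul_right]
    simp [h]
  rw [Fintype.linearIndependent_iff] at hR ⊢
  intro c hc
  set X : V := ∑ j, (((c j).re : ℝ) : ℂ) • (ω j : V) with hX
  set Y : V := ∑ j, (((c j).im : ℝ) : ℂ) • (ω j : V) with hY
  have hXY : X + Complex.I • Y = 0 := by
    rw [← hc, hX, hY, Finset.smul_sum, ← Finset.sum_add_distrib]
    refine Finset.sum_congr rfl fun j _ => ?_
    rw [smul_smul, ← add_smul]
    congr 1
    rw [mul_comm]
    exact Complex.re_add_im (c j)
  have hX' : X = -(Complex.I • Y) := eq_neg_of_add_eq_zero_left hXY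
  have hY0 : Y = 0 := by
    have h := him (fun j => (c j).re) (fun j => (c j).im)
    change (inner ℂ X Y : ℂ).im = 0 at h
    rw [hX', inner_neg_left, inner_smul_left, inner_self_eq_norm_sq_to_K] at h
    have h2 : ‖Y‖ ^ 2 = 0 := by
      simpa [← Complex.ofReal_pow] using h
    exact norm_eq_zero.1 (pow_eq_zero_iff two_ne_zero |>.1 h2)
  have hX0 : X = 0 := by simp [hX', hY0]
  intro j
  have h1 := hR (fun j => (c j).re) (by simpa [hX, Complex.coe_smul] using hX0) j
  have h2 := hR (fun j => (c j).im) (by simpa [hY, Complex.coe_smul] using hY0) j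
  exact Complex.ext h1 h2

theorem span_lattice {V : Type*} [NormedAddCommGroup V] [InnerProductSpace ℂ V]
    {Γ : AddSubgroup V} {r : ℕ} (ω : Basis (Fin r) ℤ Γ) :
    Submodule.span ℂ (Set.range fun j => (ω j : V)) = cspan Γ := by
  apply le_antisymm
  · refine Submodule.span_mono ?_
    rintro _ ⟨j, rfl⟩
    exact (ω j).2
  · refine Submodule.span_le.2 fun γ hγ => ?_
    have h := congrArg (Subtype.val) (ω.sum_repr ⟨γ, hγ⟩)
    rw [AddSubgroup.val_finsetSum] at h
    change _ = γ at h
    rw [← h]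
    refine Submodule.sum_mem _ fun j _ => ?_
    rw [AddSubgroup.coe_zsmul]
    exact zsmul_mem (Submodule.subset_span (Set.mem_range_self j)) _

theorem param_bijective {V : Type*} [NormedAddCommGroup V] [InnerProductSpace ℂ V]
    [FiniteDimensional ℂ V] {Γ : AddSubgroup V} [DiscreteTopology Γ] (hΓ : IsIsotropic Γ)
    {r s : ℕ} (ω : Basis (Fin r) ℤ Γ) (η : OrthonormalBasis (Fin s) ℂ (cspan Γ)ᗮ) :
    Function.Bijective (param ω η) := by
  have hη : ∀ w : Fin s → ℂ, Fintype.linearCombination ℂ (fun l => (η l : V)) w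
      = ((∑ l, w l • η l : (cspan Γ)ᗮ) : V) := by
    intro w
    simp [Fintype.linearCombination_apply]
  have hω : ∀ z : Fin r → ℂ,
      Fintype.linearCombination ℂ (fun j => (ω j : V)) z ∈ cspan Γ := by
    intro z
    rw [Fintype.linearCombination_apply]
    exact Submodule.sum_mem _ fun j _ =>
      Submodule.smul_mem _ _ (Submodule.subset_span (ω j).2)
  constructor
  · rw [injective_iff_map_eq_zero]
    rintro ⟨z, w⟩ h
    simp only [param, LinearMap.coprod_apply] at h
    have hw : Fintype.linearCombination ℂ (fun l => (η l : V)) w = 0 := by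
      have h1 := eq_neg_of_add_eq_zero_right h
      have h2 : Fintype.linearCombination ℂ (fun l => (η l : V)) w ∈ cspan Γ := by
        rw [h1]; exact Submodule.neg_mem _ (hω z)
      have h3 : Fintype.linearCombination ℂ (fun l => (η l : V)) w ∈ (cspan Γ)ᗮ := by
        rw [hη]; exact Subtype.property _
      exact inner_self_eq_zero.1 (Submodule.inner_right_of_mem_orthogonal h2 h3)
    have hz : Fintype.linearCombination ℂ (fun j => (ω j : V)) z = 0 := by
      rwa [hw, add_zero] at h
    have hz' := Fintype.linearIndependent_iff.1 (linearIndependent_complex hΓ ω) z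
      (by rwa [Fintype.linearCombination_apply] at hz)
    have hw' := Fintype.linearIndependent_iff.1 η.orthonormal.linearIndependent w
      (by rw [hη] at hw; exact Subtype.ext hw)
    exact Prod.ext (funext hz') (funext hw')
  · intro u
    obtain ⟨x, hx, y, hy, rfl⟩ := Submodule.exists_add_mem_mem_orthogonal (K := cspan Γ) u
    rw [← span_lattice ω, ← Fintype.range_linearCombination] at hx
    obtain ⟨z, rfl⟩ := hx
    refine ⟨(z, fun l => η.repr ⟨y, hy⟩ l), ?_⟩
    simp only [param, LinearMap.coprod_apply]
    rw [hη, η.sum_repr]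

/-- The coordinates `u ↦ (z, z_⊥)` of `V` with respect to `(ω, η)`, as the inverse of `param`. -/
def coords {V : Type*} [NormedAddCommGroup V] [InnerProductSpace ℂ V]
    [FiniteDimensional ℂ V] {Γ : AddSubgroup V} [DiscreteTopology Γ] (hΓ : IsIsotropic Γ)
    {r s : ℕ} (ω : Basis (Fin r) ℤ Γ) (η : OrthonormalBasis (Fin s) ℂ (cspan Γ)ᗮ) :
    V ≃ₗ[ℂ] ((Fin r → ℂ) × (Fin s → ℂ)) :=
  (LinearEquiv.ofBijective (param ω η) (param_bijective hΓ ω η)).symm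

/-- Lebesgue measure `dλ(z) dλ(z_⊥)` of the coordinate space `ℂ^r × ℂ^s`, carried to `V`. -/
def lebesgue {V : Type*} [NormedAddCommGroup V] [InnerProductSpace ℂ V] [MeasurableSpace V]
    {Γ : AddSubgroup V} {r s : ℕ} (ω : Basis (Fin r) ℤ Γ)
    (η : OrthonormalBasis (Fin s) ℂ (cspan Γ)ᗮ) : Measure V :=
  (volume : Measure ((Fin r → ℂ) × (Fin s → ℂ))).map (param ω η)

/-- The Gram matrix `B = (H(ω_j, ω_k))`; its entries are real when `Γ` is isotropic, so taking real
parts loses nothing. -/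
def gram {V : Type*} [NormedAddCommGroup V] [InnerProductSpace ℂ V] {Γ : AddSubgroup V} {r : ℕ}
    (ω : Basis (Fin r) ℤ Γ) : Matrix (Fin r) (Fin r) ℝ :=
  Matrix.of fun j k => (herm (ω j : V) (ω k : V)).re

/-- The character `χ_α(∑ m_j ω_j) = exp(2πi ∑ α_j m_j)` of `Γ`. -/
def thetaChar {V : Type*} [NormedAddCommGroup V] {Γ : AddSubgroup V} {r : ℕ}
    (ω : Basis (Fin r) ℤ Γ) (α : Fin r → ℝ) (γ : Γ) : ℂ :=
  Complex.exp (2 * Real.pi * Complex.I * ∑ j, (α j : ℂ) * (ω.repr γ j : ℂ))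

/-- `‖f‖² = ∫_D |f(u)|² exp(-ν H(u,u)) dμ(u)`, with values in `[0, ∞]`. -/
def sqNorm {V : Type*} [NormedAddCommGroup V] [InnerProductSpace ℂ V] [MeasurableSpace V]
    (ν : ℝ) (μ : Measure V) (D : Set V) (f : V → ℂ) : ℝ≥0∞ :=
  ∫⁻ u in D, ENNReal.ofReal (‖f u‖ ^ 2 * Real.exp (-ν * (herm u u).re)) ∂μ

/-- `⟨f, h⟩ = ∫_D f(u) conj(h(u)) exp(-ν H(u,u)) dμ(u)`. -/
def thetaInner {V : Type*} [NormedAddCommGroup V] [InnerProductSpace ℂ V] [MeasurableSpace V]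
    (ν : ℝ) (μ : Measure V) (D : Set V) (f h : V → ℂ) : ℂ :=
  ∫ u in D, f u * conj (h u) * (Real.exp (-ν * (herm u u).re) : ℂ) ∂μ

theorem sqNorm_add_lt_top {V : Type*} [NormedAddCommGroup V] [InnerProductSpace ℂ V]
    [MeasurableSpace V] [BorelSpace V] {ν : ℝ} {μ : Measure V} {D : Set V} {f h : V → ℂ}
    (hfc : Continuous f) (hf : sqNorm ν μ D f < ∞) (hh : sqNorm ν μ D h < ∞) :
    sqNorm ν μ D (f + h) < ∞ := by
  have hm : Measurable fun u : V =>
      ENNReal.ofReal (‖f u‖ ^ 2 * Real.exp (-ν * (herm u u).re)) := by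
    unfold herm
    fun_prop
  have key : sqNorm ν μ D (f + h) ≤ 2 * (sqNorm ν μ D f + sqNorm ν μ D h) := by
    unfold sqNorm
    rw [← lintegral_add_left hm, ← lintegral_const_mul' _ _ (by simp)]
    refine lintegral_mono fun u => ?_
    rw [← ENNReal.ofReal_add (by positivity) (by positivity), ← ENNReal.ofReal_ofNat 2,
      ← ENNReal.ofReal_mul (by norm_num)]
    refine ENNReal.ofReal_le_ofReal ?_
    have h1 : ‖(f + h) u‖ ^ 2 ≤ 2 * (‖f u‖ ^ 2 + ‖h u‖ ^ 2) := by
      have h2 : ‖(f + h) u‖ ≤ ‖f u‖ + ‖h u‖ := norm_add_le _ _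
      have h3 := pow_le_pow_left₀ (norm_nonneg _) h2 2
      nlinarith [sq_nonneg (‖f u‖ - ‖h u‖)]
    have h4 := mul_le_mul_of_nonneg_right h1 (Real.exp_nonneg (-ν * (herm u u).re))
    linarith
  exact key.trans_lt (ENNReal.mul_lt_top (by simp) (ENNReal.add_lt_top.2 ⟨hf, hh⟩))

/-- The theta Fock–Bargmann space: entire functions `f` on `V` with
`f(u + γ) = χ(γ) exp(ν H(u + γ/2, γ)) f(u)` for `γ ∈ Γ`, and finite norm on `D`
(a fundamental domain of `Γ`). -/
def space {V : Type*} [NormedAddCommGroup V] [InnerProductSpace ℂ V] [MeasurableSpace V]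
    [BorelSpace V] (ν : ℝ) (Γ : AddSubgroup V) (χ : Γ → ℂ) (μ : Measure V) (D : Set V) :
    Submodule ℂ (V → ℂ) where
  carrier := {f | Differentiable ℂ f ∧
    (∀ (u : V) (γ : Γ), f (u + γ) =
      χ γ * Complex.exp (ν * herm (u + (1 / 2 : ℂ) • (γ : V)) (γ : V)) * f u) ∧
    sqNorm ν μ D f < ∞}
  zero_mem' := by
    refine ⟨differentiable_const 0, fun u γ => by simp, ?_⟩
    simp [sqNorm]
  add_mem' := by
    rintro f h ⟨hf1, hf2, hf3⟩ ⟨hh1, hh2, hh3⟩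
    refine ⟨hf1.add hh1, fun u γ => ?_, sqNorm_add_lt_top hf1.continuous hf3 hh3⟩
    simp only [Pi.add_apply, hf2 u γ, hh2 u γ]
    ring
  smul_mem' := by
    rintro c f ⟨hf1, hf2, hf3⟩
    refine ⟨hf1.const_smul c, fun u γ => ?_, ?_⟩
    · simp only [Pi.smul_apply, hf2 u γ, smul_eq_mul]
      ring
    · have : sqNorm ν μ D (c • f) = ENNReal.ofReal (‖c‖ ^ 2) * sqNorm ν μ D f := by
        unfold sqNorm
        rw [← lintegral_const_mul' _ _ ENNReal.ofReal_ne_top]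
        refine lintegral_congr fun u => ?_
        rw [← ENNReal.ofReal_mul (by positivity), Pi.smul_apply, norm_smul]
        congr 1
        ring
      rw [this]
      exact ENNReal.mul_lt_top ENNReal.ofReal_lt_top hf3

/-- `e_{n,k}(z, z_⊥) = exp((ν/2) B(z,z) + 2πi (α+n)·z) z_⊥^k`, as a function on `V`, where
`B(z,z) = ∑ z_i z_j H(ω_i, ω_j)`. -/
def thetaFun {V : Type*} [NormedAddCommGroup V] [InnerProductSpace ℂ V]
    [FiniteDimensional ℂ V] {Γ : AddSubgroup V} [DiscreteTopology Γ] (hΓ : IsIsotropic Γ)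
    {r s : ℕ} (ω : Basis (Fin r) ℤ Γ) (η : OrthonormalBasis (Fin s) ℂ (cspan Γ)ᗮ)
    (ν : ℝ) (α : Fin r → ℝ) (n : Fin r → ℤ) (k : Fin s → ℕ) (u : V) : ℂ :=
  let z : Fin r → ℂ := (coords hΓ ω η u).1
  let w : Fin s → ℂ := (coords hΓ ω η u).2
  Complex.exp (ν / 2 * ∑ i, ∑ j, z i * z j * herm (ω i : V) (ω j : V)
      + 2 * Real.pi * Complex.I * ∑ j, ((α j : ℂ) + (n j : ℂ)) * z j)
    * ∏ l, w l ^ k l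

/-- `(1/√det B) (π/2ν)^{r/2} (π/ν)^s (k!/ν^{|k|}) exp((2π²/ν) (n+α) B⁻¹ (n+α))`. -/
def thetaWeight {r s : ℕ} (B : Matrix (Fin r) (Fin r) ℝ) (ν : ℝ) (α : Fin r → ℝ)
    (n : Fin r → ℤ) (k : Fin s → ℕ) : ℝ :=
  (1 / √B.det) * (Real.pi / (2 * ν)) ^ ((r : ℝ) / 2) * (Real.pi / ν) ^ s
    * ((∏ l, ((k l).factorial : ℝ)) / ν ^ (∑ l, k l))
    * Real.exp (2 * Real.pi ^ 2 / ν *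
        ((fun j => (n j : ℝ) + α j) ⬝ᵥ (B⁻¹ *ᵥ (fun j => (n j : ℝ) + α j))))

end

end ThetaFB

/-!
The functions `e_{n,k}` are products of the nowhere vanishing Gaussian factor
`exp((ν/2) B(z,z) + 2πi α·z)` (`gaussFactor`), which does not depend on `(n, k)`, and of
`exp(2πi n·z) w^k` (`expMonomial`), where `w = z_⊥`. An entire function `f` on `V` has the theta
automorphy factor if and only if its quotient `F` by the Gaussian factor (`reduced`) is
`ℤ^r`-periodic in `z` (`reduced_add_intCast`). Moreover `|f|² exp(-ν H)` is `|F|²` times a density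
that depends only on `y = Im z` and on the moduli `|w_l|` (`thetaDensity`).

Substituting `w_l = exp(2πi ζ_l)` turns `F` into an entire function on `ℂ^r × ℂ^s` which is periodic
under all integral translations. For such a function, the mean against `exp(-2πi m·ζ)` over a real
unit cube shifted by `c ∈ ℂ^(r+s)` is holomorphic in `c`, and it scales by an explicit exponential in
`c` because it does so for real `c`; so one family of coefficients `a_{n,k}` describes all Fourier
series of `F` on the tori `{Im z = y, |w_l| = ρ_l}`. Negative exponents of `w` do not occur, since `F`
stays bounded as `w_l → 0`.

On each torus, Parseval's identity expresses the mean of `|F|²` as the sum of the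
`|a_{n,k}|² |exp(2πi n·z) w^k|²`. Integrating this against the density, with the strip
`{Re z ∈ (0,1]^r}` as fundamental domain, gives the identity
`‖f‖² = ∑ |a_{n,k}|² W_{n,k}` in `[0, ∞]` (`sqNorm_eq_tsum`), valid for every entire `f` with the theta
automorphy factor; the weights `W_{n,k}` are Gaussian integrals, equal to `thetaWeight`. Everything
else follows from it. It contains the norms of the `e_{n,k}` and, by polarization, their
orthogonality. It bounds the tail of an expansion, whence convergence in norm and the density of the
span. If the right-hand side is finite, then the arithmetic-geometric mean inequality together with
the convergence of `∑ |e_{n,k}(u)|² / W_{n,k}`, uniformly on balls, shows that the series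
`∑ a_{n,k} e_{n,k}` converges absolutely and locally uniformly (`exists_summable_bound`). Its sum is
entire, and it agrees with `f` wherever no `w_l` vanishes, hence everywhere.
-/

namespace ThetaFB

/-! ### Fourier series on the unit cube -/

/-- The circle `ℝ / ℤ` carries its Haar measure of total mass `1`, the normalization that the
multivariate Fourier series of Mathlib uses. -/
noncomputable local instance : MeasureSpace UnitAddCircle := ⟨AddCircle.haarAddCircle⟩

local instance : Measure.IsAddHaarMeasure (volume : Measure UnitAddCircle) :=
  inferInstanceAs (Measure.IsAddHaarMeasure AddCircle.haarAddCircle)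

local instance : IsProbabilityMeasure (volume : Measure UnitAddCircle) :=
  inferInstanceAs (IsProbabilityMeasure AddCircle.haarAddCircle)

/-- The half-open unit cube `(0, 1]^ι`. -/
def unitCube (ι : Type*) : Set (ι → ℝ) := {x | ∀ i, x i ∈ Set.Ioc (0 : ℝ) 1}

/-- The exponential `exp(2πi ∑ m_j ζ_j)` on `ℂ^ι`. -/
noncomputable def expChar {ι : Type*} [Fintype ι] (m : ι → ℤ) (ζ : ι → ℂ) : ℂ :=
  Complex.exp (2 * Real.pi * Complex.I * ∑ j, (m j : ℂ) * ζ j)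

theorem unitCube_eq_pi {ι : Type*} : unitCube ι = Set.univ.pi fun _ => Set.Ioc (0 : ℝ) 1 := by
  ext x; simp [unitCube]

/-- A continuous `ℤ^ι`-periodic function on `ℝ^ι` descends to the torus. -/
theorem exists_torus_lift {ι E : Type*} [TopologicalSpace E] {G : (ι → ℝ) → E} (hG : Continuous G)
    (hper : ∀ (m : ι → ℤ) x, G (x + fun j => (m j : ℝ)) = G x) :
    ∃ F : C(UnitAddTorus ι, E), ∀ x : ι → ℝ, F (fun j => (x j : UnitAddCircle)) = G x := by
  let q : (ι → ℝ) → UnitAddTorus ι := Pi.map fun _ x => (x : UnitAddCircle)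
  have hq : IsOpenQuotientMap q :=
    IsOpenQuotientMap.piMap fun _ => QuotientAddGroup.isOpenQuotientMap_mk
  let s : UnitAddTorus ι → (ι → ℝ) := Function.surjInv hq.surjective
  have hs : ∀ x, G (s (q x)) = G x := by
    intro x
    have h := Function.surjInv_eq hq.surjective (q x)
    have h2 : ∀ j, ∃ m : ℤ, s (q x) j = x j + m := by
      intro j
      have h3 : ((s (q x) j : ℝ) : UnitAddCircle) = (x j : UnitAddCircle) := congrFun h j
      obtain ⟨m, hm⟩ := (AddCircle.coe_eq_zero_iff 1).1
        (show ((s (q x) j - x j : ℝ) : UnitAddCircle) = 0 by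
          rw [AddCircle.coe_sub, h3, sub_self])
      exact ⟨m, by rw [zsmul_one] at hm; linarith⟩
    choose m hm using h2
    rw [show s (q x) = x + fun j => (m j : ℝ) from funext hm, hper]
  refine ⟨⟨G ∘ s, ?_⟩, hs⟩
  rw [hq.isQuotientMap.continuous_iff]
  exact hG.congr fun x => (hs x).symm

section

variable {ι : Type*} [Fintype ι]

theorem expChar_add_right (m : ι → ℤ) (ζ ξ : ι → ℂ) :
    expChar m (ζ + ξ) = expChar m ζ * expChar m ξ := by
  simp only [expChar, ← Complex.exp_add, Pi.add_apply, mul_add, Finset.sum_add_distrib]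

theorem expChar_add_left (m n : ι → ℤ) (ζ : ι → ℂ) :
    expChar (m + n) ζ = expChar m ζ * expChar n ζ := by
  simp only [expChar, ← Complex.exp_add, Pi.add_apply, Int.cast_add, add_mul,
    Finset.sum_add_distrib, mul_add]

theorem expChar_zero_left (ζ : ι → ℂ) : expChar 0 ζ = 1 := by simp [expChar]

theorem expChar_neg_mul_self (m : ι → ℤ) (ζ : ι → ℂ) : expChar (-m) ζ * expChar m ζ = 1 := by
  rw [← expChar_add_left, neg_add_cancel, expChar_zero_left]

theorem expChar_intCast (m k : ι → ℤ) : expChar m (fun j => (k j : ℂ)) = 1 := by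
  rw [expChar, Complex.exp_eq_one_iff]
  exact ⟨∑ j, m j * k j, by push_cast; ring⟩

theorem norm_expChar (m : ι → ℤ) (ζ : ι → ℂ) :
    ‖expChar m ζ‖ = Real.exp (-(2 * Real.pi * ∑ j, (m j : ℝ) * (ζ j).im)) := by
  rw [expChar, Complex.norm_exp]
  congr 1
  have : (2 * Real.pi * Complex.I * ∑ j, (m j : ℂ) * ζ j)
      = Complex.I * ((2 * Real.pi : ℝ) * ∑ j, (m j : ℂ) * ζ j) := by push_cast; ring
  rw [this, Complex.I_mul_re, Complex.im_ofReal_mul, Complex.im_sum]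
  simp

theorem norm_expChar_ofReal (m : ι → ℤ) (x : ι → ℝ) : ‖expChar m (fun j => (x j : ℂ))‖ = 1 := by
  simp [norm_expChar]

theorem differentiable_expChar (m : ι → ℤ) : Differentiable ℂ (expChar m) := by
  unfold expChar; fun_prop

theorem measurableSet_unitCube : MeasurableSet (unitCube ι) :=
  MeasurableSet.univ_pi' fun _ => measurableSet_Ioc

theorem volume_unitCube : volume (unitCube ι) = 1 := by
  rw [unitCube_eq_pi, Real.volume_pi_Ioc]; simp

instance : IsProbabilityMeasure (volume.restrict (unitCube ι)) :=
  ⟨by rw [Measure.restrict_apply_univ, volume_unitCube]⟩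

theorem integrableOn_unitCube {E : Type*} [NormedAddCommGroup E] {f : (ι → ℝ) → E}
    (hf : Continuous f) : IntegrableOn f (unitCube ι) := by
  have h : IsCompact (Set.univ.pi fun _ : ι => Set.Icc (0 : ℝ) 1) :=
    isCompact_univ_pi fun _ => isCompact_Icc
  refine (hf.continuousOn.integrableOn_compact h).mono_set ?_
  rw [unitCube_eq_pi]
  exact Set.pi_mono fun _ _ => Set.Ioc_subset_Icc_self

theorem mFourier_coe (m : ι → ℤ) (x : ι → ℝ) :
    UnitAddTorus.mFourier m (fun j => (x j : UnitAddCircle)) = expChar m (fun j => (x j : ℂ)) := by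
  simp only [UnitAddTorus.mFourier, ContinuousMap.coe_mk, fourier_coe_apply, expChar,
    Finset.mul_sum, Complex.exp_sum]
  refine Finset.prod_congr rfl fun j _ => ?_
  congr 1
  push_cast
  ring

/-- The Fourier coefficient `∫_{(0,1]^ι} exp(-2πi m·x) G(x) dx`. -/
noncomputable def cubeCoeff (G : (ι → ℝ) → ℂ) (m : ι → ℤ) : ℂ :=
  ∫ x in unitCube ι, expChar (-m) (fun j => (x j : ℂ)) * G x

theorem mFourierCoeff_eq_cubeCoeff {G : (ι → ℝ) → ℂ} {F : C(UnitAddTorus ι, ℂ)}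
    (h : ∀ x : ι → ℝ, F (fun j => (x j : UnitAddCircle)) = G x) (m : ι → ℤ) :
    UnitAddTorus.mFourierCoeff F m = cubeCoeff G m := by
  rw [UnitAddTorus.mFourierCoeff_eq_integral _ _ 0, cubeCoeff]
  simp only [mFourier_coe, h, unitCube, Pi.zero_apply, zero_add, smul_eq_mul]

/-- Integrals of periodic functions over the unit cube are invariant under translations. -/
theorem setIntegral_unitCube_add {G : (ι → ℝ) → ℂ} (hG : Continuous G)
    (hper : ∀ (m : ι → ℤ) x, G (x + fun j => (m j : ℝ)) = G x) (a : ι → ℝ) :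
    ∫ x in unitCube ι, G (x + a) = ∫ x in unitCube ι, G x := by
  obtain ⟨F, hF⟩ := exists_torus_lift hG hper
  let b : UnitAddTorus ι := fun j => (a j : UnitAddCircle)
  have h1 := UnitAddTorus.integral_preimage (fun t => F (t + b)) 0
  have h2 := UnitAddTorus.integral_preimage F 0
  rw [integral_add_right_eq_self F b, h2] at h1
  simp only [Pi.zero_apply, zero_add, hF] at h1
  change ∫ x in unitCube ι, G x = _ at h1
  rw [h1]
  change _ = ∫ x in unitCube ι, _
  congr 1
  funext x
  rw [← hF]
  rfl

theorem hasSum_sq_cubeCoeff {G : (ι → ℝ) → ℂ} (hG : Continuous G)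
    (hper : ∀ (m : ι → ℤ) x, G (x + fun j => (m j : ℝ)) = G x) :
    HasSum (fun m => ‖cubeCoeff G m‖ ^ 2) (∫ x in unitCube ι, ‖G x‖ ^ 2) := by
  obtain ⟨F, hF⟩ := exists_torus_lift hG hper
  have h := UnitAddTorus.hasSum_sq_mFourierCoeff (ContinuousMap.toLp 2 _ ℂ F)
  simp only [UnitAddTorus.mFourierCoeff_toLp, mFourierCoeff_eq_cubeCoeff hF] at h
  convert h using 1
  have h2 := UnitAddTorus.integral_preimage (fun t => ‖F t‖ ^ 2) 0
  simp only [Pi.zero_apply, zero_add, hF] at h2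
  refine h2.symm.trans (integral_congr_ae ?_)
  filter_upwards [ContinuousMap.coeFn_toLp (p := 2) (𝕜 := ℂ) _ F] with t ht
  rw [ht]

theorem hasSum_cubeCoeff {G : (ι → ℝ) → ℂ} (hG : Continuous G)
    (hper : ∀ (m : ι → ℤ) x, G (x + fun j => (m j : ℝ)) = G x) (hs : Summable (cubeCoeff G))
    (x : ι → ℝ) : HasSum (fun m => cubeCoeff G m * expChar m (fun j => (x j : ℂ))) (G x) := by
  obtain ⟨F, hF⟩ := exists_torus_lift hG hper
  have h := UnitAddTorus.hasSum_mFourier_series_apply_of_summable (f := F)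
    (by rwa [show UnitAddTorus.mFourierCoeff F = cubeCoeff G from
      funext (mFourierCoeff_eq_cubeCoeff hF)]) (fun j => (x j : UnitAddCircle))
  simpa only [mFourierCoeff_eq_cubeCoeff hF, mFourier_coe, hF, smul_eq_mul] using h

theorem continuous_expChar_ofReal (m : ι → ℤ) :
    Continuous fun x : ι → ℝ => expChar m (fun j => (x j : ℂ)) := by
  unfold expChar; fun_prop

theorem setIntegral_expChar (m : ι → ℤ) :
    ∫ x in unitCube ι, expChar m (fun j => (x j : ℂ)) = if m = 0 then 1 else 0 := by
  classical
  split_ifs with h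
  · subst h
    simp [expChar_zero_left]
  · obtain ⟨i, hi⟩ := Function.ne_iff.1 h
    let a : ι → ℝ := Pi.single i (1 / (2 * m i))
    have hi' : (m i : ℂ) ≠ 0 := by exact_mod_cast hi
    have ha : expChar m (fun j => (a j : ℂ)) = -1 := by
      rw [expChar, Finset.sum_eq_single i]
      · rw [← Complex.exp_pi_mul_I]
        congr 1
        simp only [a, Pi.single_eq_same]
        push_cast
        field_simp
      · intro j _ hj
        simp [a, hj]
      · simp
    have h1 := setIntegral_unitCube_add (continuous_expChar_ofReal m) (fun k x => by
      have := expChar_add_right m (fun j => (x j : ℂ)) (fun j => (k j : ℂ))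
      rw [expChar_intCast, mul_one] at this
      rw [← this]
      congr 1
      ext j; simp) a
    have h2 : ∀ x : ι → ℝ, expChar m (fun j => ((x + a) j : ℂ))
        = -expChar m (fun j => (x j : ℂ)) := by
      intro x
      have := expChar_add_right m (fun j => (x j : ℂ)) (fun j => (a j : ℂ))
      rw [ha, mul_neg_one] at this
      rw [← this]
      congr 1
      ext j; simp
    simp only [h2, integral_neg] at h1
    exact self_eq_neg.1 h1.symm

/-- The coefficients of an absolutely convergent trigonometric series are its Fourier
coefficients. -/
theorem cubeCoeff_eq_of_hasSum {G : (ι → ℝ) → ℂ} {a : (ι → ℤ) → ℂ} (ha : Summable fun m => ‖a m‖)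
    (h : ∀ x, HasSum (fun m => a m * expChar m (fun j => (x j : ℂ))) (G x)) : cubeCoeff G = a := by
  funext n
  have h1 := hasSum_integral_of_summable_integral_norm (μ := volume.restrict (unitCube ι))
    (F := fun m x => expChar (-n) (fun j => (x j : ℂ)) * (a m * expChar m (fun j => (x j : ℂ))))
    (fun m => integrableOn_unitCube ((continuous_expChar_ofReal _).mul
      (continuous_const.mul (continuous_expChar_ofReal _))))
    (by simpa [norm_mul, norm_expChar_ofReal] using ha)
  have h2 : ∀ x : ι → ℝ, ∑' m, expChar (-n) (fun j => (x j : ℂ)) *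
      (a m * expChar m (fun j => (x j : ℂ))) = expChar (-n) (fun j => (x j : ℂ)) * G x :=
    fun x => ((h x).mul_left _).tsum_eq
  simp only [h2] at h1
  refine h1.unique ?_
  convert! hasSum_ite_eq n (a n) using 2
  rename_i m
  have h3 : ∀ x : ι → ℝ, expChar (-n) (fun j => (x j : ℂ)) * (a m * expChar m (fun j => (x j : ℂ)))
      = a m * expChar (m - n) (fun j => (x j : ℂ)) := by
    intro x
    rw [sub_eq_neg_add, expChar_add_left]
    ring
  simp only [h3, integral_const_mul, setIntegral_expChar, sub_eq_zero]
  split_ifs with hmn <;> simp [hmn]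

end

/-! ### Fourier coefficients of entire periodic functions -/

/-- A parametric integral over the unit cube of a jointly continuous function that is entire in the
parameter is entire. -/
theorem differentiable_setIntegral_unitCube {ι : Type*} [Fintype ι] {K : ℂ → (ι → ℝ) → ℂ}
    (hK : Continuous (Function.uncurry K)) (hd : ∀ x, Differentiable ℂ fun t => K t x) :
    Differentiable ℂ fun t => ∫ x in unitCube ι, K t x := by
  intro t₀
  have hcomp : IsCompact (Metric.closedBall t₀ 2 ×ˢ (Set.univ.pi fun _ : ι => Set.Icc (0 : ℝ) 1)) :=
    (isCompact_closedBall t₀ 2).prod (isCompact_univ_pi fun _ => isCompact_Icc)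
  obtain ⟨M, hM⟩ := hcomp.exists_bound_of_continuousOn hK.continuousOn
  have hcube : ∀ x ∈ unitCube ι, x ∈ Set.univ.pi fun _ : ι => Set.Icc (0 : ℝ) 1 :=
    fun x hx i _ => Set.Ioc_subset_Icc_self (hx i)
  refine (hasDerivAt_integral_of_dominated_loc_of_deriv_le (μ := volume.restrict (unitCube ι))
    (F := K) (F' := fun t x => deriv (fun t => K t x) t) (bound := fun _ => M)
    (Metric.ball_mem_nhds t₀ one_pos)
    (Filter.Eventually.of_forall fun t => (Continuous.aestronglyMeasurable (by fun_prop)))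
    (integrableOn_unitCube (by fun_prop)) ?_ ?_ (integrable_const M) ?_).2.differentiableAt
  · have h := stronglyMeasurable_deriv_with_param (f := fun (x : ι → ℝ) (t : ℂ) => K t x)
      (hK.comp continuous_swap)
    exact (h.comp_measurable (measurable_id.prodMk measurable_const)).aestronglyMeasurable
  · rw [ae_restrict_iff' measurableSet_unitCube]
    refine Filter.Eventually.of_forall fun x hx t ht => ?_
    have h := Complex.norm_deriv_le_of_forall_mem_sphere_norm_le (c := t) (C := M) one_pos
      (hd x).diffContOnCl (fun w hw => hM (w, x) ⟨?_, hcube x hx⟩)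
    · simpa using h
    · rw [Metric.mem_closedBall]
      rw [Metric.mem_ball] at ht
      rw [Metric.mem_sphere] at hw
      linarith [dist_triangle w t t₀]
  · exact Filter.Eventually.of_forall fun x t _ => (hd x t).hasDerivAt

theorem continuous_comp_add_ofReal {ι : Type*} {Φ : (ι → ℂ) → ℂ} (hΦ : Continuous Φ) (ζ : ι → ℂ) :
    Continuous fun x : ι → ℝ => Φ (ζ + fun j => (x j : ℂ)) :=
  hΦ.comp (by fun_prop)

theorem periodic_comp_add_ofReal {ι : Type*} {Φ : (ι → ℂ) → ℂ}
    (hper : ∀ (m : ι → ℤ) ζ, Φ (ζ + fun j => (m j : ℂ)) = Φ ζ) (ζ : ι → ℂ) (m : ι → ℤ)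
    (x : ι → ℝ) : Φ (ζ + fun j => ((x + fun j => (m j : ℝ)) j : ℂ)) =
      Φ (ζ + fun j => (x j : ℂ)) := by
  refine Eq.trans ?_ (hper m (ζ + fun j => (x j : ℂ)))
  congr 1
  ext j
  simp only [Pi.add_apply]
  push_cast
  ring

section

variable {ι : Type*} [Fintype ι]

/-- The mean of an entire `ℤ^ι`-periodic function over the cube `ζ + (0,1]^ι` does not depend on
`ζ`: it is holomorphic in `ζ` and invariant under real translations. -/
theorem setIntegral_unitCube_shift {Ψ : (ι → ℂ) → ℂ} (hΨ : Differentiable ℂ Ψ)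
    (hper : ∀ (m : ι → ℤ) ζ, Ψ (ζ + fun j => (m j : ℂ)) = Ψ ζ) (ζ : ι → ℂ) :
    ∫ x in unitCube ι, Ψ (ζ + fun j => (x j : ℂ)) = ∫ x in unitCube ι, Ψ fun j => (x j : ℂ) := by
  have hreal : ∀ (ζ : ι → ℂ) (a : ι → ℝ), ∫ x in unitCube ι, Ψ ((ζ + fun j => (a j : ℂ)) +
      fun j => (x j : ℂ)) = ∫ x in unitCube ι, Ψ (ζ + fun j => (x j : ℂ)) := by
    intro ζ a
    rw [← setIntegral_unitCube_add (G := fun x => Ψ (ζ + fun j => (x j : ℂ)))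
      (hΨ.continuous.comp (by fun_prop)) (fun m x => ?_) a]
    · congr 1
      funext x
      congr 1
      ext j
      simp only [Pi.add_apply]
      push_cast
      ring
    · refine Eq.trans ?_ (hper m (ζ + fun j => (x j : ℂ)))
      congr 1
      ext j
      simp only [Pi.add_apply]
      push_cast
      ring
  let v : ι → ℝ := fun j => (ζ j).im
  let g : ℂ → ℂ := fun t => ∫ x in unitCube ι, Ψ (((fun j => ((ζ j).re : ℂ)) +
    fun j => t * (v j : ℂ)) + fun j => (x j : ℂ))
  have hg : Differentiable ℂ g := differentiable_setIntegral_unitCube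
    (hΨ.continuous.comp (by fun_prop)) (fun x => hΨ.comp (by fun_prop))
  have hgr : ∀ (t : ℂ) (a : ℝ), g (t + a) = g t := by
    intro t a
    simp only [g]
    refine Eq.trans ?_ (hreal _ fun j => a * v j)
    congr 1
    funext x
    congr 1
    ext j
    simp only [Pi.add_apply]
    push_cast
    ring
  have hg0 : ∀ t, deriv g t = 0 := by
    intro t
    have h1 : HasDerivAt (fun a : ℝ => g (t + a)) (deriv g t) 0 := by
      have h := (hg (t + ((0 : ℝ) : ℂ))).hasDerivAt.comp_const_add t _
      simpa using h.comp_ofReal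
    simp only [hgr] at h1
    exact h1.unique (hasDerivAt_const _ _)
  have h1 := is_const_of_deriv_eq_zero hg hg0 Complex.I 0
  have h2 := hreal 0 fun j => (ζ j).re
  simp only [zero_add] at h2
  rw [← h2]
  convert! h1 using 3
  · congr 1
    ext j
    simp only [Pi.add_apply, v]
    rw [mul_comm Complex.I, Complex.re_add_im]
  · congr 1
    ext j
    simp

/-- The Fourier coefficients of `x ↦ Φ(ζ + x)`, for `Φ` entire and periodic, are those of `Φ`
itself multiplied by `exp(2πi m·ζ)`. -/
theorem cubeCoeff_shift {Φ : (ι → ℂ) → ℂ} (hΦ : Differentiable ℂ Φ)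
    (hper : ∀ (m : ι → ℤ) ζ, Φ (ζ + fun j => (m j : ℂ)) = Φ ζ) (ζ : ι → ℂ) (m : ι → ℤ) :
    cubeCoeff (fun x => Φ (ζ + fun j => (x j : ℂ))) m =
      expChar m ζ * cubeCoeff (fun x => Φ fun j => (x j : ℂ)) m := by
  have h := setIntegral_unitCube_shift (Ψ := fun ζ => expChar (-m) ζ * Φ ζ)
    ((differentiable_expChar _).mul hΦ)
    (fun k ζ => by rw [expChar_add_right, expChar_intCast, mul_one, hper]) ζ
  rw [cubeCoeff, cubeCoeff, ← h, ← integral_const_mul]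
  congr 1
  funext x
  rw [expChar_add_right]
  linear_combination (-(expChar (-m) (fun j => (x j : ℂ)) *
    Φ (ζ + fun j => (x j : ℂ)))) * expChar_neg_mul_self m ζ

/-- Parseval's identity for an entire periodic function on a translate of the real cube. -/
theorem hasSum_sq_cubeCoeff_shift {Φ : (ι → ℂ) → ℂ} (hΦ : Differentiable ℂ Φ)
    (hper : ∀ (m : ι → ℤ) ζ, Φ (ζ + fun j => (m j : ℂ)) = Φ ζ) (ζ : ι → ℂ) :
    HasSum (fun m => ‖cubeCoeff (fun x => Φ fun j => (x j : ℂ)) m * expChar m ζ‖ ^ 2)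
      (∫ x in unitCube ι, ‖Φ (ζ + fun j => (x j : ℂ))‖ ^ 2) := by
  have h := hasSum_sq_cubeCoeff (continuous_comp_add_ofReal hΦ.continuous ζ)
    (periodic_comp_add_ofReal hper ζ)
  simpa only [cubeCoeff_shift hΦ hper ζ, mul_comm] using h

theorem hasSum_cubeCoeff_shift {Φ : (ι → ℂ) → ℂ} (hΦ : Differentiable ℂ Φ)
    (hper : ∀ (m : ι → ℤ) ζ, Φ (ζ + fun j => (m j : ℂ)) = Φ ζ) (ζ : ι → ℂ)
    (hs : Summable fun m => cubeCoeff (fun x => Φ fun j => (x j : ℂ)) m * expChar m ζ) :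
    HasSum (fun m => cubeCoeff (fun x => Φ fun j => (x j : ℂ)) m * expChar m ζ) (Φ ζ) := by
  have h := hasSum_cubeCoeff (continuous_comp_add_ofReal hΦ.continuous ζ)
    (periodic_comp_add_ofReal hper ζ)
    (by convert! hs using 2; rw [cubeCoeff_shift hΦ hper ζ, mul_comm]) 0
  simp only [cubeCoeff_shift hΦ hper ζ] at h
  have h0 : (fun j : ι => (((0 : ι → ℝ) j : ℝ) : ℂ)) = 0 := by ext; simp
  have h1 : ∀ m : ι → ℤ, expChar m (0 : ι → ℂ) = 1 := fun m => by simp [expChar]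
  simpa only [h0, h1, add_zero, mul_one, one_mul, mul_comm (expChar _ _)] using h

end

/-! ### Expansions in the functions `exp(2πi n·z) w^k` -/

section

variable {ι κ : Type*} [Fintype ι] [Fintype κ]

/-- The map `ζ ↦ exp(2πi ζ)`, coordinate by coordinate. -/
noncomputable def expCoord {κ : Type*} (ζ : κ → ℂ) : κ → ℂ :=
  fun l => Complex.exp (2 * Real.pi * Complex.I * ζ l)

theorem differentiable_expCoord : Differentiable ℂ (expCoord : (κ → ℂ) → κ → ℂ) := by
  unfold expCoord; fun_prop

theorem exists_expCoord_eq {κ : Type*} {w : κ → ℂ} (hw : ∀ l, w l ≠ 0) : ∃ ζ, expCoord ζ = w := by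
  refine ⟨fun l => Complex.log (w l) / (2 * Real.pi * Complex.I), funext fun l => ?_⟩
  have h : (2 * Real.pi * Complex.I : ℂ) ≠ 0 := Complex.two_pi_I_ne_zero
  rw [expCoord, mul_div_cancel₀ _ h, Complex.exp_log (hw l)]

theorem expCoord_add {κ : Type*} (ζ ξ : κ → ℂ) : expCoord (ζ + ξ) = expCoord ζ * expCoord ξ := by
  ext l
  simp [expCoord, mul_add, Complex.exp_add]

theorem expCoord_intCast {κ : Type*} (m : κ → ℤ) : expCoord (fun l => (m l : ℂ)) = 1 := by
  ext l
  rw [expCoord, Pi.one_apply, Complex.exp_eq_one_iff]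
  exact ⟨m l, by ring⟩

theorem norm_expCoord_ofReal {κ : Type*} (x : κ → ℝ) (l : κ) :
    ‖expCoord (fun l => (x l : ℂ)) l‖ = 1 := by
  rw [expCoord, show 2 * Real.pi * Complex.I * (x l : ℂ) = ((2 * Real.pi * x l : ℝ) : ℂ) *
    Complex.I by push_cast; ring, Complex.norm_exp_ofReal_mul_I]

/-- The function `(z, ζ) ↦ h(z, exp(2πi ζ))`. It is periodic in all its variables when `h` is
periodic in the first group of variables. -/
noncomputable def expLift (h : (ι → ℂ) × (κ → ℂ) → ℂ) (ζ : ι ⊕ κ → ℂ) : ℂ :=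
  h (ζ ∘ Sum.inl, expCoord (ζ ∘ Sum.inr))

/-- The monomial `exp(2πi n·z) w^k`. -/
noncomputable def expMonomial (q : (ι → ℤ) × (κ → ℕ)) (p : (ι → ℂ) × (κ → ℂ)) : ℂ :=
  expChar q.1 p.1 * ∏ l, p.2 l ^ q.2 l

/-- The exponents `(n, k)` as a frequency in `ℤ^(ι ⊕ κ)`. -/
def toFreq {ι κ : Type*} (q : (ι → ℤ) × (κ → ℕ)) : ι ⊕ κ → ℤ :=
  Sum.elim q.1 fun l => (q.2 l : ℤ)

/-- The coefficient of `exp(2πi n·z) w^k` in the expansion of `h`. -/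
noncomputable def expCoeff (h : (ι → ℂ) × (κ → ℂ) → ℂ) (q : (ι → ℤ) × (κ → ℕ)) : ℂ :=
  cubeCoeff (fun x : ι ⊕ κ → ℝ => expLift h fun j => (x j : ℂ)) (toFreq q)

theorem toFreq_injective {ι κ : Type*} :
    Function.Injective (toFreq : (ι → ℤ) × (κ → ℕ) → ι ⊕ κ → ℤ) := by
  rintro ⟨n, k⟩ ⟨n', k'⟩ h
  refine Prod.ext (funext fun j => congrFun h (Sum.inl j)) (funext fun l => ?_)
  exact Nat.cast_injective (R := ℤ) (congrFun h (Sum.inr l))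

theorem exists_neg_of_notMem_range_toFreq {ι κ : Type*} {m : ι ⊕ κ → ℤ}
    (hm : m ∉ Set.range (toFreq : (ι → ℤ) × (κ → ℕ) → ι ⊕ κ → ℤ)) : ∃ l, m (Sum.inr l) < 0 := by
  by_contra! h
  refine hm ⟨(fun j => m (Sum.inl j), fun l => (m (Sum.inr l)).toNat), ?_⟩
  ext (j | l)
  · rfl
  · exact Int.toNat_of_nonneg (h l)

theorem expChar_toFreq (q : (ι → ℤ) × (κ → ℕ)) (ζ : ι ⊕ κ → ℂ) :
    expChar (toFreq q) ζ = expMonomial q (ζ ∘ Sum.inl, expCoord (ζ ∘ Sum.inr)) := by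
  simp only [expChar, expMonomial, toFreq, Fintype.sum_sum_type, Sum.elim_inl, Sum.elim_inr,
    mul_add, Complex.exp_add, expCoord, Function.comp, ← Complex.exp_nat_mul, ← Complex.exp_sum,
    Int.cast_natCast, Finset.mul_sum]
  congr 3
  ext l
  ring

theorem differentiable_expLift {h : (ι → ℂ) × (κ → ℂ) → ℂ} (hh : Differentiable ℂ h) :
    Differentiable ℂ (expLift h) := by
  unfold expLift Function.comp
  refine hh.comp (Differentiable.prodMk (by fun_prop) ?_)
  exact differentiable_expCoord.comp (g := expCoord) (f := fun ζ : ι ⊕ κ → ℂ => fun l => ζ (Sum.inr l))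
    (by fun_prop)

theorem expLift_add_intCast {ι κ : Type*} {h : (ι → ℂ) × (κ → ℂ) → ℂ}
    (hper : ∀ (m : ι → ℤ) z w, h (z + (fun j => (m j : ℂ)), w) = h (z, w)) (m : ι ⊕ κ → ℤ)
    (ζ : ι ⊕ κ → ℂ) : expLift h (ζ + fun j => (m j : ℂ)) = expLift h ζ := by
  have h1 : expCoord ((ζ + fun j => (m j : ℂ)) ∘ Sum.inr) = expCoord (ζ ∘ Sum.inr) := by
    have := expCoord_add (ζ ∘ Sum.inr) (fun l => ((m (Sum.inr l) : ℤ) : ℂ))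
    rw [expCoord_intCast fun l => m (Sum.inr l), mul_one] at this
    exact this
  rw [expLift, h1]
  exact hper (fun j => m (Sum.inl j)) _ _

theorem shift_expLift {ι κ : Type*} (h : (ι → ℂ) × (κ → ℂ) → ℂ) (z : ι → ℂ) (ζ : κ → ℂ)
    (x : ι ⊕ κ → ℝ) :
    expLift h (Sum.elim z ζ + fun j => (x j : ℂ)) =
      h (z + fun j => (x (Sum.inl j) : ℂ),
        expCoord (fun l => (x (Sum.inr l) : ℂ)) * expCoord ζ) := by
  rw [expLift, mul_comm, ← expCoord_add]
  rfl

/-- Frequencies with a negative entry in the second group of variables do not occur, since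
`h(z, w)` stays bounded as `w_l → 0`. -/
theorem cubeCoeff_expLift_eq_zero {h : (ι → ℂ) × (κ → ℂ) → ℂ} (hh : Differentiable ℂ h)
    (hper : ∀ (m : ι → ℤ) z w, h (z + (fun j => (m j : ℂ)), w) = h (z, w)) {m : ι ⊕ κ → ℤ}
    {l : κ} (hl : m (Sum.inr l) < 0) :
    cubeCoeff (fun x : ι ⊕ κ → ℝ => expLift h fun j => (x j : ℂ)) m = 0 := by
  classical
  set C := cubeCoeff (fun x : ι ⊕ κ → ℝ => expLift h fun j => (x j : ℂ)) m with hC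
  have hcomp : IsCompact (Metric.closedBall (0 : ι → ℂ) 1 ×ˢ Metric.closedBall (0 : κ → ℂ) 1) :=
    (isCompact_closedBall _ _).prod (isCompact_closedBall _ _)
  obtain ⟨M, hM⟩ := hcomp.exists_bound_of_continuousOn hh.continuous.continuousOn
  have key : ∀ t : ℝ, 0 ≤ t → Real.exp (2 * Real.pi * t) * ‖C‖ ≤ M := by
    intro t ht
    set ζ : ι ⊕ κ → ℂ := Pi.single (Sum.inr l) (t * Complex.I) with hζ
    have h1 := cubeCoeff_shift (differentiable_expLift hh) (expLift_add_intCast hper) ζ m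
    have h2 : ‖cubeCoeff (fun x : ι ⊕ κ → ℝ => expLift h (ζ + fun j => (x j : ℂ))) m‖ ≤ M := by
      refine (norm_integral_le_of_norm_le_const (C := M) ?_).trans (by simp)
      rw [ae_restrict_iff' measurableSet_unitCube]
      refine Filter.Eventually.of_forall fun x hx => ?_
      rw [norm_mul, norm_expChar_ofReal, one_mul]
      refine hM _ ⟨?_, ?_⟩
      · rw [mem_closedBall_zero_iff, pi_norm_le_iff_of_nonneg zero_le_one]
        intro j
        have := hx (Sum.inl j)
        simp only [hζ, Function.comp, Pi.add_apply, Pi.single_apply, reduceCtorEq, if_false,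
          zero_add, Complex.norm_real, Real.norm_eq_abs]
        exact abs_le.2 ⟨by linarith [this.1], this.2⟩
      · rw [mem_closedBall_zero_iff, pi_norm_le_iff_of_nonneg zero_le_one]
        intro j
        change ‖Complex.exp _‖ ≤ 1
        rw [Complex.norm_exp, Real.exp_le_one_iff]
        simp only [hζ, Function.comp, Pi.add_apply, Pi.single_apply, Sum.inr.injEq]
        split_ifs
        · simp only [Complex.mul_re, Complex.add_re, Complex.add_im, Complex.mul_im,
            Complex.ofReal_re, Complex.ofReal_im, Complex.I_re, Complex.I_im, Complex.re_ofNat,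
            Complex.im_ofNat]
          have := mul_nonneg Real.pi_pos.le ht
          ring_nf
          nlinarith
        · simp
    rw [h1, norm_mul, norm_expChar] at h2
    refine le_trans (mul_le_mul_of_nonneg_right (Real.exp_le_exp.2 ?_) (norm_nonneg _)) h2
    rw [Finset.sum_eq_single (Sum.inr l)]
    · have h3 : (m (Sum.inr l) : ℝ) ≤ -1 := by exact_mod_cast Int.le_sub_one_of_lt hl
      simp only [hζ, Pi.single_eq_same, Complex.mul_im, Complex.ofReal_re, Complex.I_im, mul_one,
        Complex.ofReal_im, Complex.I_re, mul_zero, add_zero]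
      have := mul_nonneg Real.pi_pos.le ht
      nlinarith
    · intro j _ hj
      simp [hζ, hj]
    · simp
  by_contra h0
  have hpos : 0 < ‖C‖ := norm_pos_iff.2 h0
  have hM0 : 0 ≤ M := le_trans (by positivity) (key 0 le_rfl)
  have h1 := key (M / ‖C‖ / (2 * Real.pi)) (by positivity)
  rw [mul_div_cancel₀ _ (by positivity), ← le_div_iff₀ hpos] at h1
  linarith [Real.add_one_le_exp (M / ‖C‖)]

/-- Parseval's identity for `h` on the torus through `(z, w)`, where no `w_l` vanishes. -/
theorem hasSum_sq_expCoeff {h : (ι → ℂ) × (κ → ℂ) → ℂ} (hh : Differentiable ℂ h)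
    (hper : ∀ (m : ι → ℤ) z w, h (z + (fun j => (m j : ℂ)), w) = h (z, w)) (z : ι → ℂ)
    {w : κ → ℂ} (hw : ∀ l, w l ≠ 0) :
    HasSum (fun q => ‖expCoeff h q * expMonomial q (z, w)‖ ^ 2)
      (∫ x in unitCube (ι ⊕ κ), ‖h (z + fun j => (x (Sum.inl j) : ℂ),
        expCoord (fun l => (x (Sum.inr l) : ℂ)) * w)‖ ^ 2) := by
  obtain ⟨ζ, rfl⟩ := exists_expCoord_eq hw
  have h1 := hasSum_sq_cubeCoeff_shift (differentiable_expLift hh) (expLift_add_intCast hper)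
    (Sum.elim z ζ)
  simp only [shift_expLift] at h1
  rw [← toFreq_injective.hasSum_iff] at h1
  · convert! h1 using 4
    simp only [expCoeff, Function.comp, expChar_toFreq]
    rfl
  · intro m hm
    obtain ⟨l, hl⟩ := exists_neg_of_notMem_range_toFreq hm
    rw [cubeCoeff_expLift_eq_zero hh hper hl]
    simp

theorem hasSum_expCoeff {h : (ι → ℂ) × (κ → ℂ) → ℂ} (hh : Differentiable ℂ h)
    (hper : ∀ (m : ι → ℤ) z w, h (z + (fun j => (m j : ℂ)), w) = h (z, w)) {z : ι → ℂ}
    {w : κ → ℂ} (hw : ∀ l, w l ≠ 0) (hs : Summable fun q => expCoeff h q * expMonomial q (z, w)) :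
    HasSum (fun q => expCoeff h q * expMonomial q (z, w)) (h (z, w)) := by
  obtain ⟨ζ, rfl⟩ := exists_expCoord_eq hw
  have h0 : ∀ m ∉ Set.range (toFreq : (ι → ℤ) × (κ → ℕ) → ι ⊕ κ → ℤ),
      cubeCoeff (fun x : ι ⊕ κ → ℝ => expLift h fun j => (x j : ℂ)) m *
        expChar m (Sum.elim z ζ) = 0 := by
    intro m hm
    obtain ⟨l, hl⟩ := exists_neg_of_notMem_range_toFreq hm
    rw [cubeCoeff_expLift_eq_zero hh hper hl, zero_mul]
  have h2 : (fun q => expCoeff h q * expMonomial q (z, expCoord ζ)) = (fun m =>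
      cubeCoeff (fun x : ι ⊕ κ → ℝ => expLift h fun j => (x j : ℂ)) m *
        expChar m (Sum.elim z ζ)) ∘ toFreq := by
    funext q
    simp only [expCoeff, Function.comp, expChar_toFreq]
    rfl
  rw [h2] at hs ⊢
  rw [toFreq_injective.hasSum_iff h0]
  exact hasSum_cubeCoeff_shift (differentiable_expLift hh) (expLift_add_intCast hper)
    (Sum.elim z ζ) ((toFreq_injective.summable_iff h0).1 hs)

/-- The coefficients of a pointwise expansion in the monomials `exp(2πi n·z) w^k` are unique. -/
theorem expCoeff_eq_of_hasSum {h : (ι → ℂ) × (κ → ℂ) → ℂ} {a : (ι → ℤ) × (κ → ℕ) → ℂ}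
    (ha : ∀ p, HasSum (fun q => a q * expMonomial q p) (h p)) : expCoeff h = a := by
  have hs : Summable fun q => ‖a q‖ := by
    have h1 := (ha (0, 1)).summable.norm
    simpa [expMonomial, expChar] using h1
  have h1 := cubeCoeff_eq_of_hasSum (G := fun x : ι ⊕ κ → ℝ => expLift h fun j => (x j : ℂ))
    (a := Function.extend toFreq a 0) ?_ ?_
  · funext q
    rw [expCoeff, h1, toFreq_injective.extend_apply]
  · rw [← toFreq_injective.summable_iff]
    · simpa [Function.comp_def, toFreq_injective.extend_apply] using hs
    · intro m hm
      simp [Function.extend_apply' _ _ _ hm]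
  · intro x
    rw [← toFreq_injective.hasSum_iff]
    · simpa only [Function.comp_def, toFreq_injective.extend_apply, expChar_toFreq, expLift]
        using ha _
    · intro m hm
      simp [Function.extend_apply' _ _ _ hm]

end

/-! ### Integration of Parseval's identity against a weight -/

section

variable {ι κ : Type*} [Fintype ι] [Fintype κ]

theorem measurePreserving_rotation (θ : κ → ℝ) :
    MeasurePreserving (fun w : κ → ℂ => expCoord (fun l => (θ l : ℂ)) * w) := by
  refine volume_preserving_pi (f := fun l (w : ℂ) => expCoord (fun l => (θ l : ℂ)) l * w) fun l => ?_
  let c : Circle := ⟨expCoord (fun l => (θ l : ℂ)) l,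
    mem_sphere_zero_iff_norm.2 (norm_expCoord_ofReal θ l)⟩
  exact (rotation c).measurePreserving

theorem ae_forall_ne_zero : ∀ᵐ w : κ → ℂ, ∀ l, w l ≠ 0 := by
  rw [ae_all_iff]
  intro l
  exact (Measure.quasiMeasurePreserving_eval (fun _ : κ => (volume : Measure ℂ)) l).ae
    (p := fun z : ℂ => z ≠ 0) (by simp [ae_iff])

theorem lintegral_unitCube_sum {f : (ι → ℝ) → (κ → ℝ) → ℝ≥0∞}
    (hf : Measurable (Function.uncurry f)) :
    ∫⁻ x in unitCube (ι ⊕ κ), f (fun j => x (Sum.inl j)) (fun l => x (Sum.inr l)) =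
      ∫⁻ θ in unitCube κ, ∫⁻ x in unitCube ι, f x θ := by
  have hmp := volume_measurePreserving_sumPiEquivProdPi (fun _ : ι ⊕ κ => ℝ)
  have hset : unitCube (ι ⊕ κ) = MeasurableEquiv.sumPiEquivProdPi (fun _ : ι ⊕ κ => ℝ) ⁻¹'
      (unitCube ι ×ˢ unitCube κ) := by
    ext x
    simp only [unitCube, Set.mem_ofPred_eq, Sum.forall, Set.mem_preimage, Set.mem_prod]
    rfl
  have h := (hmp.restrict_preimage (measurableSet_unitCube.prod measurableSet_unitCube)).lintegral_comp hf
  rw [← hset, Measure.volume_eq_prod, ← Measure.prod_restrict, lintegral_prod_symm' _ hf] at h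
  exact h

/-- Integration over `ℂ^κ` may be preceded by averaging over the rotations of the coordinates. -/
theorem lintegral_eq_lintegral_rotation {F : (κ → ℂ) → ℝ≥0∞} (hF : Measurable F) :
    ∫⁻ w, F w = ∫⁻ w, ∫⁻ θ in unitCube κ, F (expCoord (fun l => (θ l : ℂ)) * w) := by
  have hexp : Continuous fun p : (κ → ℝ) => expCoord (fun l => (p l : ℂ)) :=
    differentiable_expCoord.continuous.comp (by fun_prop)
  have h1 : ∀ θ : κ → ℝ, ∫⁻ w, F (expCoord (fun l => (θ l : ℂ)) * w) = ∫⁻ w, F w :=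
    fun θ => (measurePreserving_rotation θ).lintegral_comp hF
  rw [← lintegral_lintegral_swap]
  · simp only [h1]
    simp
  · exact (hF.comp ((hexp.comp continuous_fst).mul continuous_snd).measurable).aemeasurable

theorem enorm_sq_eq_ofReal (a : ℂ) : ‖a‖ₑ ^ 2 = ENNReal.ofReal (‖a‖ ^ 2) := by
  rw [← ofReal_norm, ENNReal.ofReal_pow (norm_nonneg _)]

theorem lintegral_torus_sq {h : (ι → ℂ) × (κ → ℂ) → ℂ} (hh : Differentiable ℂ h)
    (hper : ∀ (m : ι → ℤ) z w, h (z + (fun j => (m j : ℂ)), w) = h (z, w)) (z : ι → ℂ)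
    {w : κ → ℂ} (hw : ∀ l, w l ≠ 0) :
    ∫⁻ θ in unitCube κ, ∫⁻ x in unitCube ι, ‖h (z + (fun j => (x j : ℂ)),
      expCoord (fun l => (θ l : ℂ)) * w)‖ₑ ^ 2 =
      ∑' q, ‖expCoeff h q * expMonomial q (z, w)‖ₑ ^ 2 := by
  have hexp : Continuous fun p : (κ → ℝ) => expCoord (fun l => (p l : ℂ)) :=
    differentiable_expCoord.continuous.comp (by fun_prop)
  have hH : Continuous fun p : (ι → ℝ) × (κ → ℝ) => h (z + (fun j => (p.1 j : ℂ)),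
      expCoord (fun l => (p.2 l : ℂ)) * w) :=
    hh.continuous.comp (Continuous.prodMk (by fun_prop)
      ((hexp.comp continuous_snd).mul continuous_const))
  rw [← lintegral_unitCube_sum (f := fun x θ => ‖h (z + (fun j => (x j : ℂ)),
    expCoord (fun l => (θ l : ℂ)) * w)‖ₑ ^ 2) (hH.enorm.measurable.pow_const 2)]
  have hH' : Continuous fun x : ι ⊕ κ → ℝ => h (z + (fun j => (x (Sum.inl j) : ℂ)),
      expCoord (fun l => (x (Sum.inr l) : ℂ)) * w) :=
    hH.comp (f := fun x : ι ⊕ κ → ℝ => ((fun j => x (Sum.inl j)), (fun l => x (Sum.inr l))))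
      (by fun_prop)
  have hP := hasSum_sq_expCoeff hh hper z hw
  have hint : Integrable (fun x : ι ⊕ κ → ℝ => ‖h (z + (fun j => (x (Sum.inl j) : ℂ)),
      expCoord (fun l => (x (Sum.inr l) : ℂ)) * w)‖ ^ 2)
      (volume.restrict (unitCube (ι ⊕ κ))) := integrableOn_unitCube (hH'.norm.pow 2)
  simp only [enorm_sq_eq_ofReal]
  rw [← ofReal_integral_eq_lintegral_ofReal hint
    (Filter.Eventually.of_forall fun _ => sq_nonneg _), ← hP.tsum_eq,
    ENNReal.ofReal_tsum_of_nonneg (fun _ => sq_nonneg _) hP.summable]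

theorem measurable_enorm_expMonomial_sq (q : (ι → ℤ) × (κ → ℕ)) :
    Measurable fun p : (ι → ℂ) × (κ → ℂ) => ‖expMonomial q p‖ₑ ^ 2 := by
  unfold expMonomial expChar
  exact (Continuous.enorm (by fun_prop)).measurable.pow_const 2

theorem lintegral_slice_sq_eq_tsum {h : (ι → ℂ) × (κ → ℂ) → ℂ} (hh : Differentiable ℂ h)
    (hper : ∀ (m : ι → ℤ) z w, h (z + (fun j => (m j : ℂ)), w) = h (z, w)) (z : ι → ℂ)
    {R : (κ → ℂ) → ℝ≥0∞} (hR : Measurable R)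
    (hrot : ∀ w (θ : κ → ℝ), R (expCoord (fun l => (θ l : ℂ)) * w) = R w) :
    ∫⁻ w, ∫⁻ x in unitCube ι, ‖h (z + (fun j => (x j : ℂ)), w)‖ₑ ^ 2 * R w =
      ∑' q, ‖expCoeff h q‖ₑ ^ 2 * ∫⁻ w, ‖expMonomial q (z, w)‖ₑ ^ 2 * R w := by
  have hhm : Continuous h := hh.continuous
  have hexp : Continuous fun p : (κ → ℝ) => expCoord (fun l => (p l : ℂ)) :=
    differentiable_expCoord.continuous.comp (by fun_prop)
  have hmono : ∀ q, Measurable fun w : κ → ℂ => ‖expMonomial q (z, w)‖ₑ ^ 2 * R w :=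
    fun q => ((measurable_enorm_expMonomial_sq q).comp measurable_prodMk_left).mul hR
  have hF : Measurable fun p : (κ → ℂ) × (ι → ℝ) =>
      ‖h (z + (fun j => (p.2 j : ℂ)), p.1)‖ₑ ^ 2 * R p.1 :=
    ((Continuous.enorm (by fun_prop)).measurable.pow_const 2).mul (hR.comp measurable_fst)
  have hG : Measurable fun w => ∫⁻ x in unitCube ι,
      ‖h (z + (fun j => (x j : ℂ)), w)‖ₑ ^ 2 * R w := hF.lintegral_prod_right'
  have hpt : ∀ w : κ → ℂ, (∀ l, w l ≠ 0) → ∫⁻ θ in unitCube κ, ∫⁻ x in unitCube ι,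
      ‖h (z + (fun j => (x j : ℂ)), expCoord (fun l => (θ l : ℂ)) * w)‖ₑ ^ 2 *
        R (expCoord (fun l => (θ l : ℂ)) * w) =
      ∑' q, ‖expCoeff h q‖ₑ ^ 2 * (‖expMonomial q (z, w)‖ₑ ^ 2 * R w) := by
    intro w hw
    have hH : Continuous fun p : (κ → ℝ) × (ι → ℝ) => h (z + (fun j => (p.2 j : ℂ)),
        expCoord (fun l => (p.1 l : ℂ)) * w) :=
      hhm.comp (Continuous.prodMk (by fun_prop)
        ((hexp.comp continuous_fst).mul continuous_const))
    have hHm : Measurable fun p : (κ → ℝ) × (ι → ℝ) => ‖h (z + (fun j => (p.2 j : ℂ)),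
        expCoord (fun l => (p.1 l : ℂ)) * w)‖ₑ ^ 2 := hH.enorm.measurable.pow_const 2
    have hHθ : ∀ θ : κ → ℝ, Measurable fun x : ι → ℝ => ‖h (z + (fun j => (x j : ℂ)),
        expCoord (fun l => (θ l : ℂ)) * w)‖ₑ ^ 2 :=
      fun θ => (hH.comp (Continuous.prodMk_right θ)).enorm.measurable.pow_const 2
    have hHi : Measurable fun θ : κ → ℝ => ∫⁻ x in unitCube ι, ‖h (z + (fun j => (x j : ℂ)),
        expCoord (fun l => (θ l : ℂ)) * w)‖ₑ ^ 2 := hHm.lintegral_prod_right'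
    have e1 : ∀ θ : κ → ℝ, ∫⁻ x in unitCube ι, ‖h (z + (fun j => (x j : ℂ)),
        expCoord (fun l => (θ l : ℂ)) * w)‖ₑ ^ 2 * R w = (∫⁻ x in unitCube ι,
        ‖h (z + (fun j => (x j : ℂ)), expCoord (fun l => (θ l : ℂ)) * w)‖ₑ ^ 2) * R w :=
      fun θ => lintegral_mul_const _ (hHθ θ)
    simp only [hrot]
    rw [lintegral_congr e1, lintegral_mul_const _ hHi, lintegral_torus_sq hh hper z hw,
      ← ENNReal.tsum_mul_right]
    exact tsum_congr fun q => by rw [enorm_mul, mul_pow, mul_assoc]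
  rw [lintegral_eq_lintegral_rotation hG,
    lintegral_congr_ae (ae_forall_ne_zero.mono fun w hw => hpt w hw),
    lintegral_tsum fun q => ((hmono q).const_mul _).aemeasurable]
  exact tsum_congr fun q => lintegral_const_mul _ (hmono q)

/-- Integrating Parseval's identity over the tori: the weighted `L²` norm of `h` over
`{Re z ∈ (0,1]^ι}` is the sum of the weighted norms of the terms of its expansion. -/
theorem lintegral_sq_eq_tsum {h : (ι → ℂ) × (κ → ℂ) → ℂ} (hh : Differentiable ℂ h)
    (hper : ∀ (m : ι → ℤ) z w, h (z + (fun j => (m j : ℂ)), w) = h (z, w))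
    {Q : (ι → ℝ) → (κ → ℂ) → ℝ≥0∞} (hQ : Measurable (Function.uncurry Q))
    (hrot : ∀ y w (θ : κ → ℝ), Q y (expCoord (fun l => (θ l : ℂ)) * w) = Q y w) :
    ∫⁻ y, ∫⁻ w, ∫⁻ x in unitCube ι,
        ‖h ((fun j => (y j : ℂ) * Complex.I) + (fun j => (x j : ℂ)), w)‖ₑ ^ 2 * Q y w =
      ∑' q, ‖expCoeff h q‖ₑ ^ 2 *
        ∫⁻ y, ∫⁻ w, ‖expMonomial q ((fun j => (y j : ℂ) * Complex.I), w)‖ₑ ^ 2 * Q y w := by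
  have hmono : ∀ q, Measurable fun y : ι → ℝ => ∫⁻ w : κ → ℂ,
      ‖expMonomial q ((fun j => (y j : ℂ) * Complex.I), w)‖ₑ ^ 2 * Q y w := by
    intro q
    refine Measurable.lintegral_prod_right' (f := fun p : (ι → ℝ) × (κ → ℂ) =>
      ‖expMonomial q ((fun j => (p.1 j : ℂ) * Complex.I), p.2)‖ₑ ^ 2 * Q p.1 p.2) ?_
    exact ((measurable_enorm_expMonomial_sq q).comp
      (Continuous.measurable (by fun_prop))).mul hQ
  have step : ∀ y, ∫⁻ w, ∫⁻ x in unitCube ι,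
        ‖h ((fun j => (y j : ℂ) * Complex.I) + (fun j => (x j : ℂ)), w)‖ₑ ^ 2 * Q y w =
      ∑' q, ‖expCoeff h q‖ₑ ^ 2 *
        ∫⁻ w, ‖expMonomial q ((fun j => (y j : ℂ) * Complex.I), w)‖ₑ ^ 2 * Q y w :=
    fun y => lintegral_slice_sq_eq_tsum hh hper _ (hQ.comp measurable_prodMk_left) (hrot y)
  rw [lintegral_congr step, lintegral_tsum fun q => ((hmono q).const_mul _).aemeasurable]
  exact tsum_congr fun q => lintegral_const_mul _ (hmono q)

/-- Lebesgue measure on `ℂ^ι` in terms of real and imaginary parts. -/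
theorem measurePreserving_add_mul_I :
    MeasurePreserving (fun p : (ι → ℝ) × (ι → ℝ) => fun j =>
      (p.2 j : ℂ) * Complex.I + (p.1 j : ℂ)) := by
  have h1 := (volume_measurePreserving_arrowProdEquivProdArrow ℝ ℝ ι).symm
  have h2 := volume_preserving_pi fun _ : ι => Complex.volume_preserving_equiv_real_prod.symm
  convert! h2.comp h1 using 1
  ext p j
  change _ = Complex.mk (p.1 j) (p.2 j)
  rw [add_comm, Complex.mk_eq_add_mul_I]

theorem setLIntegral_re_mem_unitCube {G : (ι → ℂ) × (κ → ℂ) → ℝ≥0∞} (hG : Measurable G) :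
    ∫⁻ p in {p : (ι → ℂ) × (κ → ℂ) | (fun j => (p.1 j).re) ∈ unitCube ι}, G p =
      ∫⁻ y : ι → ℝ, ∫⁻ w, ∫⁻ x in unitCube ι,
        G ((fun j => (y j : ℂ) * Complex.I) + (fun j => (x j : ℂ)), w) := by
  have hre : Measurable fun z : ι → ℂ => fun j => (z j).re := by fun_prop
  have hm := measurePreserving_add_mul_I (ι := ι)
  have hSm : MeasurableSet {z : ι → ℂ | (fun j => (z j).re) ∈ unitCube ι} :=
    hre measurableSet_unitCube
  have hset : {p : (ι → ℂ) × (κ → ℂ) | (fun j => (p.1 j).re) ∈ unitCube ι} =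
      {z : ι → ℂ | (fun j => (z j).re) ∈ unitCube ι} ×ˢ Set.univ := by ext; simp
  have hset2 : (fun p : (ι → ℝ) × (ι → ℝ) => fun j => (p.2 j : ℂ) * Complex.I + (p.1 j : ℂ)) ⁻¹'
      {z : ι → ℂ | (fun j => (z j).re) ∈ unitCube ι} = unitCube ι ×ˢ Set.univ := by
    ext; simp
  have hG1 : Measurable fun z : ι → ℂ => ∫⁻ w, G (z, w) := hG.lintegral_prod_right'
  rw [hset, Measure.volume_eq_prod, ← Measure.prod_restrict, lintegral_prod _ hG.aemeasurable,
    Measure.restrict_univ, ← (hm.restrict_preimage hSm).lintegral_comp hG1,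
    hset2, Measure.volume_eq_prod, ← Measure.prod_restrict, Measure.restrict_univ]
  refine (lintegral_prod_symm' _ (hG1.comp hm.measurable)).trans (lintegral_congr fun y => ?_)
  refine lintegral_lintegral_swap (Measurable.aemeasurable ?_)
  refine hG.comp (Measurable.prodMk ?_ measurable_snd)
  fun_prop

end

/-! ### Gaussian integrals -/

open scoped MatrixOrder in
theorem exists_symm_sqrt {ι : Type*} [Fintype ι] [DecidableEq ι] {B : Matrix ι ι ℝ}
    (hB : B.PosDef) : ∃ A : Matrix ι ι ℝ, Aᵀ = A ∧ A * A = B := by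
  refine ⟨CFC.sqrt B, ?_, CFC.sqrt_mul_sqrt_self B hB.posSemidef.nonneg⟩
  have h := (Matrix.nonneg_iff_posSemidef.1 (CFC.sqrt_nonneg B)).isHermitian
  rwa [Matrix.IsHermitian, Matrix.conjTranspose_eq_transpose_of_trivial] at h

theorem lintegral_exp_neg_sq_sub {ι : Type*} [Fintype ι] {b : ℝ} (hb : 0 < b) (d : ι → ℝ) :
    ∫⁻ v : ι → ℝ, ENNReal.ofReal (Real.exp (-b * (v ⬝ᵥ v) + d ⬝ᵥ v)) =
      ENNReal.ofReal ((Real.pi / b) ^ ((Fintype.card ι : ℝ) / 2) *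
        Real.exp ((d ⬝ᵥ d) / (4 * b))) := by
  have hb' : 0 < (b : ℂ).re := by simpa using hb
  have e : ∀ v : ι → ℝ, Complex.exp (-(b : ℂ) * ∑ i, (v i : ℂ) ^ 2 + ∑ i, (d i : ℂ) * v i) =
      ((Real.exp (-b * (v ⬝ᵥ v) + d ⬝ᵥ v) : ℝ) : ℂ) := by
    intro v
    push_cast [dotProduct]
    simp only [sq]
  have h1 := GaussianFourier.integral_cexp_neg_mul_sum_add hb' (fun i => (d i : ℂ))
  have h2 := GaussianFourier.integrable_cexp_neg_mul_sum_add hb' (fun i => (d i : ℂ))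
  simp only [e] at h1 h2
  rw [integral_complex_ofReal] at h1
  have h3 : Integrable fun v : ι → ℝ => Real.exp (-b * (v ⬝ᵥ v) + d ⬝ᵥ v) := by
    simpa only [RCLike.re_eq_complex_re, Complex.ofReal_re] using h2.re
  rw [← ofReal_integral_eq_lintegral_ofReal h3 (Filter.Eventually.of_forall fun _ => by positivity)]
  congr 1
  rw [← Complex.ofReal_inj, h1]
  rw [Complex.ofReal_mul, Complex.ofReal_cpow (by positivity)]
  push_cast [dotProduct]
  simp only [sq]

/-- The Gaussian integral with quadratic form `B` and a linear term, by the substitution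
`v = √B y`. -/
theorem lintegral_exp_neg_quadratic_sub {ι : Type*} [Fintype ι] [DecidableEq ι]
    {B : Matrix ι ι ℝ} (hB : B.PosDef) {ν : ℝ} (hν : 0 < ν) (c : ι → ℝ) :
    ∫⁻ y : ι → ℝ, ENNReal.ofReal (Real.exp (-(2 * ν) * (y ⬝ᵥ B *ᵥ y) -
        4 * Real.pi * (c ⬝ᵥ y))) =
      ENNReal.ofReal ((1 / √B.det) * (Real.pi / (2 * ν)) ^ ((Fintype.card ι : ℝ) / 2) *
        Real.exp (2 * Real.pi ^ 2 / ν * (c ⬝ᵥ (B⁻¹ *ᵥ c)))) := by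
  obtain ⟨A, hAt, hA⟩ := exists_symm_sqrt hB
  have hdet : A.det * A.det = B.det := by rw [← Matrix.det_mul, hA]
  have hBd := hB.det_pos
  have hA0 : A.det ≠ 0 := fun h => by rw [← hdet, h] at hBd; simp at hBd
  have hAu : IsUnit A.det := isUnit_iff_ne_zero.2 hA0
  set d : ι → ℝ := A⁻¹ *ᵥ c with hd
  have hAi : A⁻¹ᵀ = A⁻¹ := by rw [Matrix.transpose_nonsing_inv, hAt]
  have hdd : d ⬝ᵥ d = c ⬝ᵥ (B⁻¹ *ᵥ c) := by
    rw [hd, ← hA, Matrix.mul_inv_rev, ← Matrix.mulVec_mulVec, Matrix.dotProduct_mulVec c,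
      ← Matrix.mulVec_transpose, hAi]
  have hq : ∀ y, y ⬝ᵥ B *ᵥ y = (A *ᵥ y) ⬝ᵥ (A *ᵥ y) := by
    intro y
    rw [← hA, ← Matrix.mulVec_mulVec, Matrix.dotProduct_mulVec y, ← Matrix.mulVec_transpose, hAt]
  have hl : ∀ y, c ⬝ᵥ y = d ⬝ᵥ (A *ᵥ y) := by
    intro y
    rw [Matrix.dotProduct_mulVec d, ← Matrix.mulVec_transpose, hAt, hd, Matrix.mulVec_mulVec,
      Matrix.mul_nonsing_inv _ hAu, Matrix.one_mulVec]
  have hmap := Real.map_matrix_volume_pi_eq_smul_volume_pi hA0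
  have hmeas : Measurable fun v : ι → ℝ => ENNReal.ofReal (Real.exp (-(2 * ν) * (v ⬝ᵥ v) +
      ((-(4 * Real.pi)) • d) ⬝ᵥ v)) := by
    simp only [dotProduct]; fun_prop
  have hlin : Measurable (Matrix.toLin' A) := (Matrix.toLin' A).continuous_of_finiteDimensional.measurable
  have h1 := lintegral_map (μ := volume) hmeas hlin
  rw [hmap, lintegral_smul_measure, lintegral_exp_neg_sq_sub (by positivity)] at h1
  have h2 : ∀ y : ι → ℝ, -(2 * ν) * (y ⬝ᵥ B *ᵥ y) - 4 * Real.pi * (c ⬝ᵥ y) =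
      -(2 * ν) * (Matrix.toLin' A y ⬝ᵥ Matrix.toLin' A y) +
        ((-(4 * Real.pi)) • d) ⬝ᵥ Matrix.toLin' A y := by
    intro y
    rw [Matrix.toLin'_apply, hq, hl, smul_dotProduct, smul_eq_mul]
    ring
  simp only [h2]
  rw [← h1, smul_eq_mul, ← ENNReal.ofReal_mul (abs_nonneg _)]
  congr 1
  have h3 : |A.det⁻¹| = 1 / √B.det := by
    rw [← hdet, Real.sqrt_mul_self_eq_abs, abs_inv, one_div]
  rw [h3, mul_assoc]
  congr 3
  rw [smul_dotProduct, dotProduct_smul, hdd, smul_eq_mul, smul_eq_mul]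
  field_simp
  ring

theorem integral_norm_pow_mul_exp_neg {ν : ℝ} (hν : 0 < ν) (k : ℕ) :
    ∫ w : ℂ, ‖w‖ ^ (2 * k) * Real.exp (-ν * ‖w‖ ^ 2) = Real.pi / ν * (k.factorial / ν ^ k) := by
  have h := Complex.integral_rpow_mul_exp_neg_mul_rpow (p := 2) (q := ((2 * k : ℕ) : ℝ)) one_le_two
    (by have : (0 : ℝ) ≤ ((2 * k : ℕ) : ℝ) := Nat.cast_nonneg _
        linarith) hν
  simp only [Real.rpow_natCast, Real.rpow_two] at h
  rw [h]
  have e1 : (((2 * k : ℕ) : ℝ) + 2) / 2 = (k : ℝ) + 1 := by push_cast; ring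
  have e2 : -(((2 * k : ℕ) : ℝ) + 2) / 2 = -((k + 1 : ℕ) : ℝ) := by push_cast; ring
  rw [e1, e2, Real.Gamma_nat_eq_factorial, Real.rpow_neg hν.le, Real.rpow_natCast, pow_succ]
  field_simp

theorem lintegral_prod_norm_pow_mul_exp_neg {κ : Type*} [Fintype κ] {ν : ℝ} (hν : 0 < ν)
    (k : κ → ℕ) :
    ∫⁻ w : κ → ℂ, ENNReal.ofReal (∏ l, (‖w l‖ ^ (2 * k l) * Real.exp (-ν * ‖w l‖ ^ 2))) =
      ENNReal.ofReal ((Real.pi / ν) ^ Fintype.card κ *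
        ((∏ l, ((k l).factorial : ℝ)) / ν ^ (∑ l, k l))) := by
  have h := integral_fintype_prod_volume_eq_prod (𝕜 := ℝ) (E := fun _ : κ => ℂ)
    (fun l w => ‖w‖ ^ (2 * k l) * Real.exp (-ν * ‖w‖ ^ 2))
  simp only [integral_norm_pow_mul_exp_neg hν] at h
  have hne : ∏ l, (Real.pi / ν * ((k l).factorial / ν ^ k l)) ≠ 0 :=
    Finset.prod_ne_zero_iff.2 fun l _ => by positivity
  rw [← ofReal_integral_eq_lintegral_ofReal, h]
  · congr 1
    rw [Finset.prod_mul_distrib, Finset.prod_const, Finset.card_univ, Finset.prod_div_distrib,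
      Finset.prod_pow_eq_pow_sum]
  · by_contra hni
    rw [integral_undef hni] at h
    exact hne h.symm
  · exact Filter.Eventually.of_forall fun w => Finset.prod_nonneg fun l _ => by positivity

/-! ### The theta factor and the density in coordinates -/

/-- The common factor `exp((ν/2) B(z,z) + 2πi α·z)` of the functions `e_{n,k}`. -/
noncomputable def gaussFactor {r : ℕ} (B : Matrix (Fin r) (Fin r) ℝ) (ν : ℝ) (α : Fin r → ℝ)
    (z : Fin r → ℂ) : ℂ :=
  Complex.exp (ν / 2 * ∑ i, ∑ j, z i * z j * (B i j : ℂ) +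
    2 * Real.pi * Complex.I * ∑ j, (α j : ℂ) * z j)

/-- The density `|exp((ν/2) B(z,z) + 2πi α·z)|² exp(-ν H(u,u))`, which depends only on `y = Im z`
and `w = z_⊥`. -/
noncomputable def thetaDensity {r s : ℕ} (B : Matrix (Fin r) (Fin r) ℝ) (ν : ℝ) (α : Fin r → ℝ)
    (y : Fin r → ℝ) (w : Fin s → ℂ) : ℝ :=
  Real.exp (-(2 * ν) * (y ⬝ᵥ B *ᵥ y) - 4 * Real.pi * (α ⬝ᵥ y)) *
    ∏ l, Real.exp (-ν * ‖w l‖ ^ 2)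

section

variable {r s : ℕ} {B : Matrix (Fin r) (Fin r) ℝ} {ν : ℝ} {α : Fin r → ℝ}

theorem gaussFactor_ne_zero (z : Fin r → ℂ) : gaussFactor B ν α z ≠ 0 := Complex.exp_ne_zero _

theorem differentiable_gaussFactor : Differentiable ℂ (gaussFactor B ν α) := by
  unfold gaussFactor; fun_prop

theorem differentiable_expMonomial (q : (Fin r → ℤ) × (Fin s → ℕ)) :
    Differentiable ℂ (expMonomial q) := by
  unfold expMonomial expChar
  refine Differentiable.mul (by fun_prop) ?_
  intro p
  exact (HasFDerivAt.finsetProd fun l _ =>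
    (show DifferentiableAt ℂ (fun p : (Fin r → ℂ) × (Fin s → ℂ) => p.2 l ^ q.2 l) p by
      fun_prop).hasFDerivAt).differentiableAt

theorem gaussFactor_add_intCast (hB : Bᵀ = B) (z : Fin r → ℂ) (m : Fin r → ℤ) :
    gaussFactor B ν α (z + fun j => (m j : ℂ)) =
      Complex.exp (2 * Real.pi * Complex.I * ∑ j, (α j : ℂ) * (m j : ℂ)) *
        Complex.exp (ν * ∑ i, ∑ j, (z i + (m i : ℂ) / 2) * (m j : ℂ) * (B i j : ℂ)) *
        gaussFactor B ν α z := by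
  simp only [gaussFactor, ← Complex.exp_add]
  congr 1
  have h1 : ∑ i, ∑ j, (m i : ℂ) * z j * (B i j : ℂ) = ∑ i, ∑ j, z i * (m j : ℂ) * (B i j : ℂ) := by
    rw [Finset.sum_comm]
    refine Finset.sum_congr rfl fun i _ => Finset.sum_congr rfl fun j _ => ?_
    rw [← hB, Matrix.transpose_apply, hB]
    ring
  have h2 : ∑ i, ∑ j, (z + fun j => (m j : ℂ)) i * (z + fun j => (m j : ℂ)) j * (B i j : ℂ) =
      ∑ i, ∑ j, z i * z j * (B i j : ℂ) + ∑ i, ∑ j, z i * (m j : ℂ) * (B i j : ℂ) +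
        ∑ i, ∑ j, (m i : ℂ) * z j * (B i j : ℂ) + ∑ i, ∑ j, (m i : ℂ) * m j * (B i j : ℂ) := by
    simp only [← Finset.sum_add_distrib, Pi.add_apply]
    refine Finset.sum_congr rfl fun i _ => Finset.sum_congr rfl fun j _ => ?_
    ring
  have h3 : ∑ i, ∑ j, (z i + (m i : ℂ) / 2) * (m j : ℂ) * (B i j : ℂ) =
      ∑ i, ∑ j, z i * (m j : ℂ) * (B i j : ℂ) +
        (1 / 2) * ∑ i, ∑ j, (m i : ℂ) * m j * (B i j : ℂ) := by
    simp only [← Finset.sum_add_distrib, Finset.mul_sum]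
    refine Finset.sum_congr rfl fun i _ => Finset.sum_congr rfl fun j _ => ?_
    ring
  rw [h2, h1, h3]
  simp only [Pi.add_apply, mul_add, Finset.sum_add_distrib]
  ring

theorem expMonomial_add_intCast (q : (Fin r → ℤ) × (Fin s → ℕ)) (m : Fin r → ℤ) (z : Fin r → ℂ)
    (w : Fin s → ℂ) : expMonomial q (z + (fun j => (m j : ℂ)), w) = expMonomial q (z, w) := by
  simp only [expMonomial, expChar_add_right, expChar_intCast, mul_one]

theorem sq_norm_gaussFactor_mul_exp (z : Fin r → ℂ) (w : Fin s → ℂ) :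
    ‖gaussFactor B ν α z‖ ^ 2 * Real.exp (-ν * (∑ i, ∑ j, (z i * conj (z j)).re * B i j +
      ∑ l, ‖w l‖ ^ 2)) = thetaDensity B ν α (fun j => (z j).im) w := by
  rw [gaussFactor, Complex.norm_exp, ← Real.exp_nat_mul, ← Real.exp_add, thetaDensity,
    ← Real.exp_sum, ← Real.exp_add]
  congr 1
  have e1 : (ν / 2 * ∑ i, ∑ j, z i * z j * (B i j : ℂ) : ℂ) =
      ((ν / 2 : ℝ) : ℂ) * ∑ i, ∑ j, z i * z j * (B i j : ℂ) := by push_cast; ring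
  have e2 : (2 * Real.pi * Complex.I * ∑ j, (α j : ℂ) * z j : ℂ) =
      ((2 * Real.pi : ℝ) : ℂ) * (Complex.I * ∑ j, (α j : ℂ) * z j) := by push_cast; ring
  have e3 : ∀ i j, (z i * z j * (B i j : ℂ)).re = (z i * z j).re * B i j :=
    fun i j => Complex.re_mul_ofReal _ _
  have e4 : ∑ i, ∑ j, (z i * z j).re * B i j - ∑ i, ∑ j, (z i * conj (z j)).re * B i j =
      -2 * ((fun j => (z j).im) ⬝ᵥ B *ᵥ fun j => (z j).im) := by
    simp only [dotProduct, Matrix.mulVec, Finset.mul_sum, ← Finset.sum_sub_distrib]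
    refine Finset.sum_congr rfl fun i _ => Finset.sum_congr rfl fun j _ => ?_
    simp only [Complex.mul_re, Complex.conj_re, Complex.conj_im]
    ring
  have e5 : ∀ j, ((α j : ℂ) * z j).im = α j * (z j).im := fun j => Complex.im_ofReal_mul _ _
  rw [e1, e2, Complex.add_re, Complex.re_ofReal_mul, Complex.re_ofReal_mul, Complex.I_mul_re,
    Complex.im_sum]
  simp only [Complex.re_sum, e3, e5]
  rw [← Finset.mul_sum]
  change _ = _ - 4 * Real.pi * (∑ j, α j * (z j).im) + _
  push_cast
  linear_combination ν * e4

theorem measurable_thetaDensity : Measurable fun p : (Fin r → ℝ) × (Fin s → ℂ) =>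
    ENNReal.ofReal (thetaDensity B ν α p.1 p.2) := by
  unfold thetaDensity dotProduct Matrix.mulVec dotProduct
  fun_prop

/-- The weighted norm of `exp(2πi n·z) w^k` over a fundamental domain. -/
theorem lintegral_sq_expMonomial (hB : B.PosDef) (hν : 0 < ν) (q : (Fin r → ℤ) × (Fin s → ℕ)) :
    ∫⁻ (y : Fin r → ℝ), ∫⁻ (w : Fin s → ℂ),
      ‖expMonomial q ((fun j => (y j : ℂ) * Complex.I), w)‖ₑ ^ 2 *
        ENNReal.ofReal (thetaDensity B ν α y w) = ENNReal.ofReal (thetaWeight B ν α q.1 q.2) := by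
  have h1 : ∀ (y : Fin r → ℝ) (w : Fin s → ℂ),
      ‖expMonomial q ((fun j => (y j : ℂ) * Complex.I), w)‖ₑ ^ 2 *
        ENNReal.ofReal (thetaDensity B ν α y w) =
      ENNReal.ofReal (Real.exp (-(2 * ν) * (y ⬝ᵥ B *ᵥ y) -
        4 * Real.pi * ((fun j => (q.1 j : ℝ) + α j) ⬝ᵥ y))) *
      ENNReal.ofReal (∏ l, (‖w l‖ ^ (2 * q.2 l) * Real.exp (-ν * ‖w l‖ ^ 2))) := by
    intro y w
    rw [enorm_sq_eq_ofReal, ← ENNReal.ofReal_mul (by positivity),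
      ← ENNReal.ofReal_mul (by positivity)]
    congr 1
    rw [expMonomial, norm_mul, norm_expChar, norm_prod, thetaDensity, mul_pow, ← Finset.prod_pow,
      Finset.prod_mul_distrib, ← Real.exp_nat_mul]
    have e1 : ∀ l, (‖w l ^ q.2 l‖ ^ 2 : ℝ) = ‖w l‖ ^ (2 * q.2 l) := fun l => by
      rw [norm_pow, ← pow_mul, mul_comm]
    have e2 : Real.exp (-(2 * ν) * (y ⬝ᵥ B *ᵥ y) -
        4 * Real.pi * ((fun j => (q.1 j : ℝ) + α j) ⬝ᵥ y)) =
        Real.exp ((2 : ℕ) * -(2 * Real.pi * ∑ j, (q.1 j : ℝ) * ((y j : ℂ) * Complex.I).im)) *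
          Real.exp (-(2 * ν) * (y ⬝ᵥ B *ᵥ y) - 4 * Real.pi * (α ⬝ᵥ y)) := by
      rw [← Real.exp_add]
      congr 1
      have : ((fun j => (q.1 j : ℝ) + α j) ⬝ᵥ y) = ∑ j, (q.1 j : ℝ) * y j + α ⬝ᵥ y := by
        simp only [dotProduct, add_mul, Finset.sum_add_distrib]
      rw [this]
      simp only [Complex.im_ofReal_mul, Complex.I_im, mul_one]
      push_cast
      ring
    simp only [e1, e2]
    ring
  simp only [h1]
  have h2 : Measurable fun w : Fin s → ℂ =>
      ENNReal.ofReal (∏ l, (‖w l‖ ^ (2 * q.2 l) * Real.exp (-ν * ‖w l‖ ^ 2))) := by fun_prop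
  simp only [lintegral_const_mul _ h2]
  have h3 : Measurable fun y : Fin r → ℝ => ENNReal.ofReal (Real.exp (-(2 * ν) * (y ⬝ᵥ B *ᵥ y) -
        4 * Real.pi * ((fun j => (q.1 j : ℝ) + α j) ⬝ᵥ y))) := by
    simp only [dotProduct, Matrix.mulVec]; fun_prop
  have h0 := hB.det_pos
  rw [lintegral_mul_const _ h3, lintegral_exp_neg_quadratic_sub hB hν,
    lintegral_prod_norm_pow_mul_exp_neg hν, ← ENNReal.ofReal_mul (by positivity), thetaWeight,
    Fintype.card_fin, Fintype.card_fin]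
  congr 1
  ring

theorem thetaWeight_pos (hB : B.PosDef) (hν : 0 < ν) (n : Fin r → ℤ) (k : Fin s → ℕ) :
    0 < thetaWeight B ν α n k := by
  have h0 := hB.det_pos
  have h1 : 0 < ∏ l, ((k l).factorial : ℝ) := Finset.prod_pos fun l _ => by positivity
  unfold thetaWeight
  positivity

theorem thetaDensity_rotation (y : Fin r → ℝ) (w : Fin s → ℂ) (θ : Fin s → ℝ) :
    thetaDensity B ν α y (expCoord (fun l => (θ l : ℂ)) * w) = thetaDensity B ν α y w := by
  simp only [thetaDensity, Pi.mul_apply, norm_mul, norm_expCoord_ofReal, one_mul]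

/-- Parseval's identity in coordinates. -/
theorem setLIntegral_sq_mul_thetaDensity (hB : B.PosDef) (hν : 0 < ν)
    {h : (Fin r → ℂ) × (Fin s → ℂ) → ℂ} (hh : Differentiable ℂ h)
    (hper : ∀ (m : Fin r → ℤ) z w, h (z + (fun j => (m j : ℂ)), w) = h (z, w)) :
    ∫⁻ p in {p : (Fin r → ℂ) × (Fin s → ℂ) | (fun j => (p.1 j).re) ∈ unitCube (Fin r)},
      ‖h p‖ₑ ^ 2 * ENNReal.ofReal (thetaDensity B ν α (fun j => (p.1 j).im) p.2) =
      ∑' q, ‖expCoeff h q‖ₑ ^ 2 * ENNReal.ofReal (thetaWeight B ν α q.1 q.2) := by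
  have hm : Measurable fun p : (Fin r → ℂ) × (Fin s → ℂ) =>
      ENNReal.ofReal (thetaDensity B ν α (fun j => (p.1 j).im) p.2) := by
    unfold thetaDensity dotProduct Matrix.mulVec dotProduct
    fun_prop
  have hG : Measurable fun p : (Fin r → ℂ) × (Fin s → ℂ) => ‖h p‖ₑ ^ 2 *
      ENNReal.ofReal (thetaDensity B ν α (fun j => (p.1 j).im) p.2) :=
    (hh.continuous.enorm.measurable.pow_const 2).mul hm
  rw [setLIntegral_re_mem_unitCube hG]
  have h1 := lintegral_sq_eq_tsum hh hper
    (Q := fun y w => ENNReal.ofReal (thetaDensity B ν α y w)) measurable_thetaDensity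
    (fun y w θ => by rw [thetaDensity_rotation])
  simp only [lintegral_sq_expMonomial hB hν] at h1
  rw [← h1]
  simp

end

/-! ### Lattice coordinates and the fundamental domain -/

section

variable {V : Type*} [NormedAddCommGroup V] {Γ : AddSubgroup V} {r : ℕ}

/-- The lattice vector with integer coordinates `m`. -/
noncomputable def latticeVec (ω : Basis (Fin r) ℤ Γ) (m : Fin r → ℤ) : Γ := ω.equivFun.symm m

theorem repr_latticeVec (ω : Basis (Fin r) ℤ Γ) (m : Fin r → ℤ) (j : Fin r) :
    ω.repr (latticeVec ω m) j = m j := by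
  rw [← ω.equivFun_apply, latticeVec, LinearEquiv.apply_symm_apply]

theorem latticeVec_surjective (ω : Basis (Fin r) ℤ Γ) : Function.Surjective (latticeVec ω) :=
  ω.equivFun.symm.surjective

theorem countable_of_basis (ω : Basis (Fin r) ℤ Γ) : Countable Γ :=
  ω.equivFun.toEquiv.countable_iff.2 inferInstance

end

section

variable {V : Type*} [NormedAddCommGroup V] [InnerProductSpace ℂ V] {Γ : AddSubgroup V} {r s : ℕ}

theorem param_apply (ω : Basis (Fin r) ℤ Γ) (η : OrthonormalBasis (Fin s) ℂ (cspan Γ)ᗮ)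
    (z : Fin r → ℂ) (w : Fin s → ℂ) :
    param ω η (z, w) = ∑ j, z j • (ω j : V) + ∑ l, w l • (η l : V) := by
  simp [param, Fintype.linearCombination_apply]

theorem coe_latticeVec (ω : Basis (Fin r) ℤ Γ) (η : OrthonormalBasis (Fin s) ℂ (cspan Γ)ᗮ)
    (m : Fin r → ℤ) : (latticeVec ω m : V) = param ω η ((fun j => (m j : ℂ)), 0) := by
  rw [param_apply, latticeVec, Basis.equivFun_symm_apply, AddSubgroup.val_finsetSum]
  simp [Int.cast_smul_eq_zsmul]

theorem herm_eq_gram (hΓ : IsIsotropic Γ) (ω : Basis (Fin r) ℤ Γ) (i j : Fin r) :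
    herm (ω i : V) (ω j : V) = (gram ω i j : ℂ) :=
  Complex.ext rfl (hΓ _ (ω i).2 _ (ω j).2)

theorem herm_param (hΓ : IsIsotropic Γ) (ω : Basis (Fin r) ℤ Γ)
    (η : OrthonormalBasis (Fin s) ℂ (cspan Γ)ᗮ) (z z' : Fin r → ℂ) (w w' : Fin s → ℂ) :
    herm (param ω η (z, w)) (param ω η (z', w')) =
      ∑ i, ∑ j, z i * conj (z' j) * (gram ω i j : ℂ) + ∑ l, w l * conj (w' l) := by
  have hω : ∀ z : Fin r → ℂ, ∑ j, z j • (ω j : V) ∈ cspan Γ := fun z =>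
    Submodule.sum_mem _ fun j _ => Submodule.smul_mem _ _ (Submodule.subset_span (ω j).2)
  have hη : ∀ w : Fin s → ℂ, ∑ l, w l • (η l : V) ∈ (cspan Γ)ᗮ := fun w =>
    Submodule.sum_mem _ fun l _ => Submodule.smul_mem _ _ (η l).2
  have hηη : ∀ l l', (inner ℂ (η l : V) (η l' : V) : ℂ) = if l = l' then 1 else 0 := fun l l' =>
    (orthonormal_iff_ite.1 η.orthonormal l l' :)
  rw [herm, param_apply, param_apply, inner_add_left, inner_add_right, inner_add_right,
    Submodule.inner_right_of_mem_orthogonal (hω z') (hη w),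
    Submodule.inner_left_of_mem_orthogonal (hω z) (hη w'), add_zero, zero_add]
  congr 1
  · rw [inner_sum]
    refine Finset.sum_congr rfl fun i _ => ?_
    rw [sum_inner]
    refine Finset.sum_congr rfl fun j _ => ?_
    rw [inner_smul_left, inner_smul_right, ← herm_eq_gram hΓ, herm]
    ring
  · rw [inner_sum]
    refine Finset.sum_congr rfl fun l _ => ?_
    rw [sum_inner, Finset.sum_eq_single l]
    · rw [inner_smul_left, inner_smul_right, hηη, if_pos rfl]
      ring
    · intro l' _ hl
      rw [inner_smul_left, inner_smul_right, hηη, if_neg hl]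
      ring
    · simp

theorem gram_transpose (ω : Basis (Fin r) ℤ Γ) : (gram ω)ᵀ = gram ω := by
  ext i j
  simp only [Matrix.transpose_apply, gram, Matrix.of_apply, herm]
  rw [← inner_conj_symm, Complex.conj_re]

theorem dotProduct_gram (ω : Basis (Fin r) ℤ Γ) (x : Fin r → ℝ) :
    x ⬝ᵥ gram ω *ᵥ x = ‖∑ j, (x j : ℂ) • (ω j : V)‖ ^ 2 := by
  have h : ((‖∑ j, (x j : ℂ) • (ω j : V)‖ ^ 2 : ℝ) : ℂ) =
      inner ℂ (∑ j, (x j : ℂ) • (ω j : V)) (∑ j, (x j : ℂ) • (ω j : V)) := by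
    rw [inner_self_eq_norm_sq_to_K]; simp
  rw [← Complex.ofReal_re (‖_‖ ^ 2), h, inner_sum, Complex.re_sum]
  refine Finset.sum_congr rfl fun i _ => ?_
  rw [sum_inner, Complex.re_sum, Matrix.mulVec, dotProduct, Finset.mul_sum]
  refine Finset.sum_congr rfl fun j _ => ?_
  rw [inner_smul_left, inner_smul_right, Complex.conj_ofReal, Complex.re_ofReal_mul,
    Complex.re_ofReal_mul, gram, Matrix.of_apply, herm]
  ring

theorem gram_posDef [FiniteDimensional ℂ V] [DiscreteTopology Γ] (ω : Basis (Fin r) ℤ Γ) :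
    (gram ω).PosDef := by
  refine Matrix.PosDef.of_dotProduct_mulVec_pos ?_ fun x hx => ?_
  · rw [Matrix.IsHermitian, Matrix.conjTranspose_eq_transpose_of_trivial, gram_transpose]
  · rw [star_trivial, dotProduct_gram]
    refine pow_pos (norm_pos_iff.2 fun h => hx ?_) 2
    simp only [Complex.coe_smul] at h
    exact funext (Fintype.linearIndependent_iff.1 (linearIndependent_real ω) x h)

theorem differentiable_param (ω : Basis (Fin r) ℤ Γ)
    (η : OrthonormalBasis (Fin s) ℂ (cspan Γ)ᗮ) : Differentiable ℂ (param ω η) :=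
  (param ω η).toContinuousLinearMap.differentiable

theorem automorphy_eq (hΓ : IsIsotropic Γ) (ω : Basis (Fin r) ℤ Γ)
    (η : OrthonormalBasis (Fin s) ℂ (cspan Γ)ᗮ) (ν : ℝ) (α : Fin r → ℝ) (m : Fin r → ℤ)
    (z : Fin r → ℂ) (w : Fin s → ℂ) :
    thetaChar ω α (latticeVec ω m) * Complex.exp (ν * herm (param ω η (z, w) +
      (1 / 2 : ℂ) • (latticeVec ω m : V)) (latticeVec ω m : V)) *
      gaussFactor (gram ω) ν α z = gaussFactor (gram ω) ν α (z + fun j => (m j : ℂ)) := by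
  rw [gaussFactor_add_intCast (gram_transpose ω), thetaChar, coe_latticeVec ω η, ← map_smul,
    ← map_add, Prod.smul_mk, Prod.mk_add_mk, herm_param hΓ]
  simp only [repr_latticeVec, Pi.add_apply, Pi.smul_apply, smul_eq_mul, Pi.zero_apply, map_zero,
    mul_zero, Finset.sum_const_zero, add_zero, map_intCast, one_div, inv_mul_eq_div]

theorem param_add_latticeVec (ω : Basis (Fin r) ℤ Γ)
    (η : OrthonormalBasis (Fin s) ℂ (cspan Γ)ᗮ) (m : Fin r → ℤ) (z : Fin r → ℂ) (w : Fin s → ℂ) :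
    param ω η (z, w) + (latticeVec ω m : V) = param ω η (z + (fun j => (m j : ℂ)), w) := by
  rw [coe_latticeVec ω η, ← map_add, Prod.mk_add_mk, add_zero]

/-- Entire functions with the automorphy factor of the theta Fock–Bargmann space, without the
integrability condition. -/
def IsThetaEntire (ν : ℝ) (Γ : AddSubgroup V) (χ : Γ → ℂ) (f : V → ℂ) : Prop :=
  Differentiable ℂ f ∧ ∀ (u : V) (γ : Γ), f (u + γ) =
    χ γ * Complex.exp (ν * herm (u + (1 / 2 : ℂ) • (γ : V)) (γ : V)) * f u

/-- A function `f` in coordinates, divided by the factor `exp((ν/2) B(z,z) + 2πi α·z)`. -/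
noncomputable def reduced (ω : Basis (Fin r) ℤ Γ) (η : OrthonormalBasis (Fin s) ℂ (cspan Γ)ᗮ)
    (ν : ℝ) (α : Fin r → ℝ) (f : V → ℂ) (p : (Fin r → ℂ) × (Fin s → ℂ)) : ℂ :=
  (gaussFactor (gram ω) ν α p.1)⁻¹ * f (param ω η p)

theorem differentiable_reduced (ω : Basis (Fin r) ℤ Γ)
    (η : OrthonormalBasis (Fin s) ℂ (cspan Γ)ᗮ) {ν : ℝ} {α : Fin r → ℝ} {f : V → ℂ}
    (hf : Differentiable ℂ f) : Differentiable ℂ (reduced ω η ν α f) :=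
  ((differentiable_gaussFactor.comp differentiable_fst).inv fun _ => gaussFactor_ne_zero _).mul
    (hf.comp (differentiable_param ω η))

theorem reduced_add_intCast (hΓ : IsIsotropic Γ) (ω : Basis (Fin r) ℤ Γ)
    (η : OrthonormalBasis (Fin s) ℂ (cspan Γ)ᗮ) {ν : ℝ} {α : Fin r → ℝ} {f : V → ℂ}
    (hf : IsThetaEntire ν Γ (thetaChar ω α) f) (m : Fin r → ℤ) (z : Fin r → ℂ) (w : Fin s → ℂ) :
    reduced ω η ν α f (z + (fun j => (m j : ℂ)), w) = reduced ω η ν α f (z, w) := by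
  have h1 := automorphy_eq hΓ ω η ν α m z w
  have h2 : gaussFactor (gram ω) ν α (z + fun j => (m j : ℂ)) ≠ 0 := gaussFactor_ne_zero _
  have h3 : gaussFactor (gram ω) ν α z ≠ 0 := gaussFactor_ne_zero _
  simp only [reduced]
  rw [← param_add_latticeVec, hf.2, inv_mul_eq_iff_eq_mul₀ h2, ← h1]
  field_simp

theorem measurable_param [MeasurableSpace V] [BorelSpace V] (ω : Basis (Fin r) ℤ Γ)
    (η : OrthonormalBasis (Fin s) ℂ (cspan Γ)ᗮ) : Measurable (param ω η) :=
  (differentiable_param ω η).continuous.measurable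

instance vaddInvariantMeasure_lebesgue [MeasurableSpace V] [BorelSpace V] (ω : Basis (Fin r) ℤ Γ)
    (η : OrthonormalBasis (Fin s) ℂ (cspan Γ)ᗮ) : VAddInvariantMeasure Γ V (lebesgue ω η) := by
  refine ⟨fun γ S hS => ?_⟩
  obtain ⟨m, rfl⟩ := latticeVec_surjective ω γ
  have hS' : MeasurableSet ((fun u : V => latticeVec ω m +ᵥ u) ⁻¹' S) :=
    measurable_const_vadd _ hS
  rw [lebesgue, Measure.map_apply (measurable_param ω η) hS,
    Measure.map_apply (measurable_param ω η) hS']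
  have h : param ω η ⁻¹' ((fun u : V => latticeVec ω m +ᵥ u) ⁻¹' S) =
      (fun p => ((fun j => (m j : ℂ)), 0) + p) ⁻¹' (param ω η ⁻¹' S) := by
    ext p
    simp only [Set.mem_preimage, map_add, ← coe_latticeVec]
    rfl
  have hmp : MeasurePreserving (fun p : (Fin r → ℂ) × (Fin s → ℂ) => ((fun j => (m j : ℂ)), 0) + p) :=
    (measurePreserving_add_left volume (fun j => (m j : ℂ))).prod
      (measurePreserving_add_left (volume : Measure (Fin s → ℂ)) 0)
  rw [h, hmp.measure_preimage (measurable_param ω η hS).nullMeasurableSet]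

/-- For functions with the theta automorphy factor the norm is the same over any fundamental
domain, because `|f(u)|² exp(-ν H(u,u))` is `Γ`-periodic. -/
theorem sqNorm_eq_of_fundamentalDomain [MeasurableSpace V] [BorelSpace V] (ω : Basis (Fin r) ℤ Γ)
    (η : OrthonormalBasis (Fin s) ℂ (cspan Γ)ᗮ) {ν : ℝ} {α : Fin r → ℝ} {f : V → ℂ}
    (hf : IsThetaEntire ν Γ (thetaChar ω α) f) {D D' : Set V}
    (hD : IsAddFundamentalDomain Γ D (lebesgue ω η))
    (hD' : IsAddFundamentalDomain Γ D' (lebesgue ω η)) :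
    sqNorm ν (lebesgue ω η) D f = sqNorm ν (lebesgue ω η) D' f := by
  have := countable_of_basis ω
  refine hD.setLIntegral_eq hD' _ fun γ u => ?_
  congr 1
  have h0 : γ +ᵥ u = u + (γ : V) := add_comm _ _
  have hχ : ‖thetaChar ω α γ‖ = 1 := by
    rw [thetaChar, Complex.norm_exp]
    have : (2 * Real.pi * Complex.I * ∑ j, (α j : ℂ) * (ω.repr γ j : ℂ) : ℂ) =
        ((2 * Real.pi * ∑ j, α j * (ω.repr γ j : ℝ) : ℝ) : ℂ) * Complex.I := by
      push_cast; ring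
    rw [this]
    simp
  rw [h0, hf.2, norm_mul, norm_mul, hχ, one_mul, mul_pow, Complex.norm_exp, ← Real.exp_nat_mul,
    mul_right_comm, ← Real.exp_add, mul_comm]
  congr 2
  have h1 : (herm u (γ : V)).re = (herm (γ : V) u).re := by
    rw [herm, herm, ← inner_conj_symm, Complex.conj_re]
  have h2 : (herm (u + (γ : V)) (u + (γ : V))).re =
      (herm u u).re + 2 * (herm u (γ : V)).re + (herm (γ : V) (γ : V)).re := by
    have : herm (u + (γ : V)) (u + (γ : V)) =
        herm u u + herm u (γ : V) + herm (γ : V) u + herm (γ : V) (γ : V) := by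
      simp only [herm, inner_add_left, inner_add_right]; ring
    rw [this]
    simp only [Complex.add_re]
    rw [← h1]
    ring
  have h3 : (herm (u + (1 / 2 : ℂ) • (γ : V)) (γ : V)).re =
      (herm u (γ : V)).re + 1 / 2 * (herm (γ : V) (γ : V)).re := by
    have : herm (u + (1 / 2 : ℂ) • (γ : V)) (γ : V) =
        herm u (γ : V) + ((1 / 2 : ℝ) : ℂ) * herm (γ : V) (γ : V) := by
      simp only [herm, inner_add_right, inner_smul_right]
      push_cast
      ring
    rw [this, Complex.add_re, Complex.re_ofReal_mul]
  rw [h2, Complex.re_ofReal_mul, h3]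
  push_cast
  ring

end

section

variable {V : Type*} [NormedAddCommGroup V] [InnerProductSpace ℂ V] [FiniteDimensional ℂ V]
  {Γ : AddSubgroup V} [DiscreteTopology Γ] {r s : ℕ}

theorem param_coords (hΓ : IsIsotropic Γ) (ω : Basis (Fin r) ℤ Γ)
    (η : OrthonormalBasis (Fin s) ℂ (cspan Γ)ᗮ) (u : V) : param ω η (coords hΓ ω η u) = u :=
  (LinearEquiv.ofBijective (param ω η) (param_bijective hΓ ω η)).apply_symm_apply u

theorem coords_param (hΓ : IsIsotropic Γ) (ω : Basis (Fin r) ℤ Γ)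
    (η : OrthonormalBasis (Fin s) ℂ (cspan Γ)ᗮ) (p : (Fin r → ℂ) × (Fin s → ℂ)) :
    coords hΓ ω η (param ω η p) = p :=
  (LinearEquiv.ofBijective (param ω η) (param_bijective hΓ ω η)).symm_apply_apply p

theorem differentiable_coords (hΓ : IsIsotropic Γ) (ω : Basis (Fin r) ℤ Γ)
    (η : OrthonormalBasis (Fin s) ℂ (cspan Γ)ᗮ) : Differentiable ℂ (coords hΓ ω η) :=
  (coords hΓ ω η).toLinearMap.toContinuousLinearMap.differentiable

theorem thetaFun_eq (hΓ : IsIsotropic Γ) (ω : Basis (Fin r) ℤ Γ)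
    (η : OrthonormalBasis (Fin s) ℂ (cspan Γ)ᗮ) (ν : ℝ) (α : Fin r → ℝ)
    (q : (Fin r → ℤ) × (Fin s → ℕ)) (u : V) :
    thetaFun hΓ ω η ν α q.1 q.2 u = gaussFactor (gram ω) ν α (coords hΓ ω η u).1 *
      expMonomial q (coords hΓ ω η u) := by
  simp only [thetaFun, gaussFactor, expMonomial, expChar, ← herm_eq_gram hΓ]
  rw [← mul_assoc, ← Complex.exp_add]
  congr 2
  simp only [add_mul, Finset.sum_add_distrib]
  ring

theorem isThetaEntire_thetaFun (hΓ : IsIsotropic Γ) (ω : Basis (Fin r) ℤ Γ)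
    (η : OrthonormalBasis (Fin s) ℂ (cspan Γ)ᗮ) (ν : ℝ) (α : Fin r → ℝ)
    (q : (Fin r → ℤ) × (Fin s → ℕ)) :
    IsThetaEntire ν Γ (thetaChar ω α) (thetaFun hΓ ω η ν α q.1 q.2) := by
  constructor
  · rw [funext (thetaFun_eq hΓ ω η ν α q)]
    exact (differentiable_gaussFactor.comp (differentiable_coords hΓ ω η).fst).mul
      ((differentiable_expMonomial q).comp (differentiable_coords hΓ ω η))
  · intro u γ
    obtain ⟨m, rfl⟩ := latticeVec_surjective ω γ
    obtain ⟨⟨z, w⟩, rfl⟩ := (param_bijective hΓ ω η).2 u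
    rw [thetaFun_eq, thetaFun_eq, param_add_latticeVec, coords_param, coords_param,
      expMonomial_add_intCast, ← automorphy_eq hΓ ω η, mul_assoc _ (gaussFactor _ _ _ _)]

/-- The standard fundamental domain `{Re z_j ∈ (0, 1]}`. -/
def stdDomain (hΓ : IsIsotropic Γ) (ω : Basis (Fin r) ℤ Γ)
    (η : OrthonormalBasis (Fin s) ℂ (cspan Γ)ᗮ) : Set V :=
  {u | (fun j => ((coords hΓ ω η u).1 j).re) ∈ unitCube (Fin r)}

variable [MeasurableSpace V] [BorelSpace V]

theorem measurableSet_stdDomain (hΓ : IsIsotropic Γ) (ω : Basis (Fin r) ℤ Γ)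
    (η : OrthonormalBasis (Fin s) ℂ (cspan Γ)ᗮ) : MeasurableSet (stdDomain hΓ ω η) := by
  have h : Measurable fun u : V => fun j => ((coords hΓ ω η u).1 j).re := by
    have := (differentiable_coords hΓ ω η).continuous
    exact Continuous.measurable (by fun_prop)
  exact h measurableSet_unitCube

theorem isAddFundamentalDomain_stdDomain (hΓ : IsIsotropic Γ) (ω : Basis (Fin r) ℤ Γ)
    (η : OrthonormalBasis (Fin s) ℂ (cspan Γ)ᗮ) :
    IsAddFundamentalDomain Γ (stdDomain hΓ ω η) (lebesgue ω η) := by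
  refine .mk' (measurableSet_stdDomain hΓ ω η).nullMeasurableSet fun u => ?_
  obtain ⟨⟨z, w⟩, rfl⟩ := (param_bijective hΓ ω η).2 u
  have h1 : ∀ m : Fin r → ℤ, latticeVec ω m +ᵥ param ω η (z, w) ∈ stdDomain hΓ ω η ↔
      ∀ j, (z j).re + m j • (1 : ℝ) ∈ Set.Ioc (0 : ℝ) (0 + 1) := by
    intro m
    have h2 : latticeVec ω m +ᵥ param ω η (z, w) = param ω η (z + (fun j => (m j : ℂ)), w) := by
      rw [← param_add_latticeVec, add_comm]; rfl
    rw [h2, stdDomain, Set.mem_ofPred_eq, coords_param]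
    simp [unitCube]
  have h2 : ∀ j, ∃! m : ℤ, (z j).re + m • (1 : ℝ) ∈ Set.Ioc (0 : ℝ) (0 + 1) :=
    fun j => existsUnique_add_zsmul_mem_Ioc one_pos _ _
  choose m hm hmu using h2
  refine ⟨latticeVec ω m, (h1 m).2 hm, fun γ hγ => ?_⟩
  obtain ⟨m', rfl⟩ := latticeVec_surjective ω γ
  congr 1
  exact funext fun j => hmu j _ ((h1 m').1 hγ j)

/-- Parseval's identity: the norm of an entire function with the theta automorphy factor in terms
of its expansion coefficients, valid in `[0, ∞]`. -/
theorem sqNorm_eq_tsum (hΓ : IsIsotropic Γ) (ω : Basis (Fin r) ℤ Γ)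
    (η : OrthonormalBasis (Fin s) ℂ (cspan Γ)ᗮ) {ν : ℝ} (hν : 0 < ν) {α : Fin r → ℝ} {f : V → ℂ}
    (hf : IsThetaEntire ν Γ (thetaChar ω α) f) {D : Set V}
    (hD : IsAddFundamentalDomain Γ D (lebesgue ω η)) :
    sqNorm ν (lebesgue ω η) D f = ∑' q, ‖expCoeff (reduced ω η ν α f) q‖ₑ ^ 2 *
      ENNReal.ofReal (thetaWeight (gram ω) ν α q.1 q.2) := by
  rw [sqNorm_eq_of_fundamentalDomain ω η hf hD (isAddFundamentalDomain_stdDomain hΓ ω η),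
    ← setLIntegral_sq_mul_thetaDensity (gram_posDef ω) hν (differentiable_reduced ω η hf.1)
    (reduced_add_intCast hΓ ω η hf)]
  have hm : Measurable fun u : V =>
      ENNReal.ofReal (‖f u‖ ^ 2 * Real.exp (-ν * (herm u u).re)) := by
    have := hf.1.continuous
    unfold herm
    fun_prop
  have hpre : param ω η ⁻¹' stdDomain hΓ ω η = {p : (Fin r → ℂ) × (Fin s → ℂ) |
      (fun j => (p.1 j).re) ∈ unitCube (Fin r)} := by
    ext p
    simp only [stdDomain, Set.mem_preimage, Set.mem_ofPred_eq, coords_param]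
  rw [sqNorm, lebesgue, setLIntegral_map (measurableSet_stdDomain hΓ ω η) hm
    (measurable_param ω η), hpre]
  refine lintegral_congr fun p => ?_
  obtain ⟨z, w⟩ := p
  have h1 := sq_norm_gaussFactor_mul_exp (B := gram ω) (ν := ν) (α := α) z w
  have h2 : (herm (param ω η (z, w)) (param ω η (z, w))).re =
      ∑ i, ∑ j, (z i * conj (z j)).re * gram ω i j + ∑ l, ‖w l‖ ^ 2 := by
    rw [herm_param hΓ]
    simp only [Complex.add_re, Complex.re_sum, Complex.re_mul_ofReal]
    congr 1
    refine Finset.sum_congr rfl fun l _ => ?_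
    rw [Complex.mul_conj, Complex.ofReal_re, Complex.normSq_eq_norm_sq]
  have h3 : ‖gaussFactor (gram ω) ν α z‖ ≠ 0 := norm_ne_zero_iff.2 (gaussFactor_ne_zero _)
  rw [h2, ← h1, enorm_sq_eq_ofReal, ← ENNReal.ofReal_mul (by positivity), reduced, norm_mul,
    norm_inv]
  congr 1
  field_simp

end

/-! ### Convergence estimates -/

theorem hasSumLocallyUniformly_of_bound {E Q : Type*} [NormedAddCommGroup E] {g : Q → E → ℂ}
    {f : E → ℂ} (H : ∀ R : ℝ, ∃ M : Q → ℝ, Summable M ∧ ∀ q u, ‖u‖ ≤ R → ‖g q u‖ ≤ M q)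
    (hf : ∀ u, HasSum (fun q => g q u) (f u)) : HasSumLocallyUniformly g f := by
  refine hasSumLocallyUniformly_of_of_forall_exists_nhds fun u => ?_
  obtain ⟨M, hM, hb⟩ := H (‖u‖ + 1)
  refine ⟨Metric.ball u 1, Metric.ball_mem_nhds _ one_pos, ?_⟩
  rw [hasSumUniformlyOn_iff_tendstoUniformlyOn]
  have h := tendstoUniformlyOn_tsum (f := g) (s := Metric.ball u 1) hM fun q v hv => hb q v ?_
  · exact h.congr_right fun v _ => (hf v).tsum_eq
  · rw [Metric.mem_ball, dist_eq_norm] at hv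
    linarith [norm_le_norm_add_norm_sub u v, norm_sub_rev u v]

/-- Cauchy's estimate for the derivative of an entire function of several variables, by restriction
to complex lines. -/
theorem norm_fderiv_le_of_bound {E : Type*} [NormedAddCommGroup E] [NormedSpace ℂ E] {g : E → ℂ}
    (hg : Differentiable ℂ g) {u : E} {M : ℝ} (hM : ∀ v, ‖v - u‖ ≤ 1 → ‖g v‖ ≤ M) :
    ‖fderiv ℂ g u‖ ≤ M := by
  have hM0 : 0 ≤ M := (norm_nonneg _).trans (hM u (by simp))
  refine ContinuousLinearMap.opNorm_le_of_unit_norm hM0 fun v hv => ?_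
  have h1 : HasDerivAt (fun t : ℂ => g (u + t • v)) (fderiv ℂ g u v) 0 := by
    have h2 : HasDerivAt (fun t : ℂ => u + t • v) v 0 := by
      simpa using ((hasDerivAt_id (0 : ℂ)).smul_const v).const_add u
    have h3 : HasFDerivAt g (fderiv ℂ g u) (u + (0 : ℂ) • v) := by
      simpa using (hg u).hasFDerivAt
    exact h3.comp_hasDerivAt 0 h2
  rw [← h1.deriv]
  have h4 : Differentiable ℂ fun t : ℂ => g (u + t • v) := hg.comp (by fun_prop)
  have h5 := Complex.norm_deriv_le_of_forall_mem_sphere_norm_le (c := 0) (C := M) one_pos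
    h4.diffContOnCl (fun t ht => hM _ ?_)
  · simpa using h5
  · rw [mem_sphere_zero_iff_norm] at ht
    simp [norm_smul, ht, hv]

theorem differentiable_of_hasSum_of_bound {E Q : Type*} [NormedAddCommGroup E] [NormedSpace ℂ E]
    {g : Q → E → ℂ} {f : E → ℂ} (hg : ∀ q, Differentiable ℂ (g q))
    (H : ∀ R : ℝ, ∃ M : Q → ℝ, Summable M ∧ ∀ q u, ‖u‖ ≤ R → ‖g q u‖ ≤ M q)
    (hf : ∀ u, HasSum (fun q => g q u) (f u)) : Differentiable ℂ f := by
  intro u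
  obtain ⟨M, hM, hb⟩ := H (‖u‖ + 2)
  have hu : u ∈ Metric.ball u 1 := Metric.mem_ball_self one_pos
  have h := hasFDerivAt_tsum_of_isPreconnected (𝕜 := ℂ) (f := g) (f' := fun q => fderiv ℂ (g q))
    hM Metric.isOpen_ball (convex_ball u 1).isPreconnected
    (fun q v _ => (hg q v).hasFDerivAt) (fun q v hv => norm_fderiv_le_of_bound (hg q)
      fun v' hv' => hb q v' ?_) hu (hf u).summable hu
  · rw [funext fun v => (hf v).tsum_eq] at h
    exact h.differentiableAt
  · rw [Metric.mem_ball, dist_eq_norm] at hv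
    have h1 := norm_le_norm_add_norm_sub' v' v
    have h2 := norm_le_norm_add_norm_sub' v u
    linarith

theorem summable_fintype_prod {ι β : Type*} [Fintype ι] {f : β → ℝ} (hf : Summable f)
    (h0 : ∀ b, 0 ≤ f b) : Summable fun x : ι → β => ∏ i, f (x i) := by
  classical
  refine summable_of_sum_le (c := ∏ _i : ι, ∑' b, f b)
    (fun x => Finset.prod_nonneg fun i _ => h0 _) fun S => ?_
  let T : ι → Finset β := fun i => S.image fun x => x i
  calc ∑ x ∈ S, ∏ i, f (x i) ≤ ∑ x ∈ Fintype.piFinset T, ∏ i, f (x i) := by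
        refine Finset.sum_le_sum_of_subset_of_nonneg (fun x hx => ?_)
          fun x _ _ => Finset.prod_nonneg fun i _ => h0 _
        exact Fintype.mem_piFinset.2 fun i => Finset.mem_image_of_mem _ hx
    _ = ∏ i, ∑ b ∈ T i, f b := (Finset.prod_univ_sum T fun _ => f).symm
    _ ≤ _ := Finset.prod_le_prod (fun i _ => Finset.sum_nonneg fun b _ => h0 b)
        fun i _ => hf.sum_le_tsum _ fun b _ => h0 b

/-- Coercivity of `B⁻¹`. -/
theorem exists_pos_mul_le_dotProduct_inv {ι : Type*} [Fintype ι] [DecidableEq ι]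
    {B : Matrix ι ι ℝ} (hB : B.PosDef) :
    ∃ δ : ℝ, 0 < δ ∧ ∀ v : ι → ℝ, δ * (v ⬝ᵥ v) ≤ v ⬝ᵥ (B⁻¹ *ᵥ v) := by
  obtain ⟨A, hAt, hA⟩ := exists_symm_sqrt hB
  have hBd := hB.det_pos
  have hdet : A.det * A.det = B.det := by rw [← Matrix.det_mul, hA]
  have hA0 : A.det ≠ 0 := fun h => by rw [← hdet, h] at hBd; simp at hBd
  have hAu : IsUnit A.det := isUnit_iff_ne_zero.2 hA0
  have hAi : A⁻¹ᵀ = A⁻¹ := by rw [Matrix.transpose_nonsing_inv, hAt]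
  set K : ℝ := ∑ i, ∑ j, A i j ^ 2 with hK
  have hK0 : 0 ≤ K := Finset.sum_nonneg fun i _ => Finset.sum_nonneg fun j _ => sq_nonneg _
  have hle : ∀ u : ι → ℝ, (A *ᵥ u) ⬝ᵥ (A *ᵥ u) ≤ K * (u ⬝ᵥ u) := by
    intro u
    rw [hK, Finset.sum_mul]
    refine Finset.sum_le_sum fun i _ => ?_
    have := Finset.sum_mul_sq_le_sq_mul_sq Finset.univ (A i) u
    simpa only [Matrix.mulVec, dotProduct, ← sq] using this
  refine ⟨(K + 1)⁻¹, by positivity, fun v => ?_⟩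
  have h1 : v ⬝ᵥ (B⁻¹ *ᵥ v) = (A⁻¹ *ᵥ v) ⬝ᵥ (A⁻¹ *ᵥ v) := by
    rw [← hA, Matrix.mul_inv_rev, ← Matrix.mulVec_mulVec, Matrix.dotProduct_mulVec v,
      ← Matrix.mulVec_transpose, hAi]
  have h2 := hle (A⁻¹ *ᵥ v)
  rw [Matrix.mulVec_mulVec, Matrix.mul_nonsing_inv _ hAu, Matrix.one_mulVec] at h2
  have h3 : 0 ≤ (A⁻¹ *ᵥ v) ⬝ᵥ (A⁻¹ *ᵥ v) := Finset.sum_nonneg fun i _ => mul_self_nonneg _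
  rw [h1, inv_mul_le_iff₀ (by positivity)]
  nlinarith

theorem norm_expMonomial_le {ι κ : Type*} [Fintype ι] [Fintype κ] (q : (ι → ℤ) × (κ → ℕ))
    {p : (ι → ℂ) × (κ → ℂ)} {R : ℝ} (hp : ‖p‖ ≤ R) :
    ‖expMonomial q p‖ ≤ (∏ j, Real.exp (2 * Real.pi * R * |(q.1 j : ℝ)|)) * ∏ l, R ^ q.2 l := by
  rw [expMonomial, norm_mul, norm_prod, norm_expChar, ← Real.exp_sum]
  have h1 : ∀ j, ‖p.1 j‖ ≤ R := fun j => (norm_le_pi_norm _ j).trans ((norm_fst_le p).trans hp)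
  have h2 : ∀ l, ‖p.2 l‖ ≤ R := fun j => (norm_le_pi_norm _ j).trans ((norm_snd_le p).trans hp)
  refine mul_le_mul (Real.exp_le_exp.2 ?_) (Finset.prod_le_prod (fun l _ => norm_nonneg _)
    fun l _ => ?_) (Finset.prod_nonneg fun l _ => norm_nonneg _) (Real.exp_nonneg _)
  · rw [Finset.mul_sum, ← Finset.sum_neg_distrib]
    refine Finset.sum_le_sum fun j _ => ?_
    have h3 : |(q.1 j : ℝ) * (p.1 j).im| ≤ |(q.1 j : ℝ)| * R := by
      rw [abs_mul]
      exact mul_le_mul_of_nonneg_left ((Complex.abs_im_le_norm _).trans (h1 j)) (abs_nonneg _)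
    have h4 := neg_le_of_abs_le h3
    nlinarith [Real.pi_pos]
  · rw [norm_pow]
    exact pow_le_pow_left₀ (norm_nonneg _) (h2 l) _

/-- The squares of the bounds for `exp(2πi n·z) w^k` on the polydisc of radius `R`, divided by the
squared norms of the functions `e_{n,k}`, are summable: this is a theta series times an exponential
series. -/
theorem summable_bound_sq_div_thetaWeight {r s : ℕ} {B : Matrix (Fin r) (Fin r) ℝ} (hB : B.PosDef)
    {ν : ℝ} (hν : 0 < ν) (α : Fin r → ℝ) (R : ℝ) :
    Summable fun q : (Fin r → ℤ) × (Fin s → ℕ) =>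
      ((∏ j, Real.exp (2 * Real.pi * R * |(q.1 j : ℝ)|)) * ∏ l, R ^ q.2 l) ^ 2 /
        thetaWeight B ν α q.1 q.2 := by
  obtain ⟨δ, hδ, hδB⟩ := exists_pos_mul_le_dotProduct_inv hB
  have hBd := hB.det_pos
  set c : ℝ := (1 / √B.det) * (Real.pi / (2 * ν)) ^ ((r : ℝ) / 2) * (Real.pi / ν) ^ s with hc
  have hc0 : 0 < c := by positivity
  let a : ℤ → ℝ := fun m => Real.exp (-Real.pi * (Real.pi * δ / ν * m ^ 2 - 2 * (2 * R) * |(m : ℝ)|))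
  let b : ℕ → ℝ := fun k => (ν * R ^ 2) ^ k / k.factorial
  have ha : Summable a := by
    simpa [a] using summable_pow_mul_jacobiTheta₂_term_bound (2 * R)
      (show 0 < Real.pi * δ / ν by positivity) 0
  have hb : Summable b := Real.summable_pow_div_factorial _
  set G : ℝ := Real.exp (2 * Real.pi ^ 2 * δ / ν * ∑ j, α j ^ 2) with hG
  have hs : Summable fun q : (Fin r → ℤ) × (Fin s → ℕ) =>
      (G / c) * ((∏ j, a (q.1 j)) * ∏ l, b (q.2 l)) :=
    ((summable_fintype_prod ha fun m => Real.exp_nonneg _).mul_of_nonneg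
      (summable_fintype_prod hb fun k => by positivity)
      (fun x => Finset.prod_nonneg fun i _ => Real.exp_nonneg _)
      (fun x => Finset.prod_nonneg fun i _ => by positivity)).mul_left _
  refine hs.of_nonneg_of_le (fun q => div_nonneg (sq_nonneg _) (thetaWeight_pos hB hν _ _).le)
    fun q => ?_
  rw [div_le_iff₀ (thetaWeight_pos hB hν _ _)]
  have hf0 : ∏ l, ((q.2 l).factorial : ℝ) ≠ 0 := Finset.prod_ne_zero_iff.2 fun l _ => by positivity
  have e1 : (∏ l, b (q.2 l)) * ((∏ l, ((q.2 l).factorial : ℝ)) / ν ^ (∑ l, q.2 l)) =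
      (∏ l, R ^ q.2 l) ^ 2 := by
    simp only [b, Finset.prod_div_distrib, Finset.prod_pow_eq_pow_sum]
    rw [mul_pow, ← pow_mul R, mul_comm 2, pow_mul]
    field_simp
  have e2 : (∏ j, Real.exp (2 * Real.pi * R * |(q.1 j : ℝ)|)) ^ 2 ≤
      G * (∏ j, a (q.1 j)) * Real.exp (2 * Real.pi ^ 2 / ν *
        ((fun j => (q.1 j : ℝ) + α j) ⬝ᵥ (B⁻¹ *ᵥ (fun j => (q.1 j : ℝ) + α j)))) := by
    simp only [a, hG]
    rw [← Real.exp_sum, ← Real.exp_sum, ← Real.exp_nat_mul, ← Real.exp_add, ← Real.exp_add,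
      Real.exp_le_exp]
    have h1 := mul_le_mul_of_nonneg_left (hδB fun j => (q.1 j : ℝ) + α j)
      (show 0 ≤ 2 * Real.pi ^ 2 / ν by positivity)
    refine le_trans ?_ (add_le_add_right h1 _)
    rw [dotProduct, Finset.mul_sum, Finset.mul_sum, Finset.mul_sum, Finset.mul_sum,
      ← Finset.sum_add_distrib, ← Finset.sum_add_distrib]
    refine Finset.sum_le_sum fun j _ => ?_
    have h2 : (q.1 j : ℝ) ^ 2 ≤ 2 * α j ^ 2 + 2 * (((q.1 j : ℝ) + α j) * ((q.1 j : ℝ) + α j)) := by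
      nlinarith [sq_nonneg ((q.1 j : ℝ) + 2 * α j)]
    have h3 := mul_le_mul_of_nonneg_left h2 (show 0 ≤ Real.pi ^ 2 * δ / ν by positivity)
    push_cast
    ring_nf at h3 ⊢
    linarith
  have h4 : 0 ≤ (∏ l, R ^ q.2 l) ^ 2 := sq_nonneg _
  calc _ = (∏ j, Real.exp (2 * Real.pi * R * |(q.1 j : ℝ)|)) ^ 2 * (∏ l, R ^ q.2 l) ^ 2 :=
        mul_pow _ _ _
    _ ≤ _ := mul_le_mul_of_nonneg_right e2 h4
    _ = _ := by
        rw [← e1, thetaWeight, ← hc]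
        field_simp

/-! ### Expansions in the theta Fock–Bargmann space -/

/-- Polarization: if `‖f + c h‖² = ‖f‖² + |c|² ‖h‖²` for all `c`, then `f` and `h` are
orthogonal. -/
theorem thetaInner_eq_zero_of_sqNorm_add {V : Type*} [NormedAddCommGroup V]
    [InnerProductSpace ℂ V] [MeasurableSpace V] [BorelSpace V] {ν : ℝ} {μ : Measure V} {D : Set V}
    {f h : V → ℂ} (hfc : Continuous f) (hhc : Continuous h) (hf : sqNorm ν μ D f < ∞)
    (hh : sqNorm ν μ D h < ∞) (H : ∀ c : ℂ, sqNorm ν μ D (f + c • h) =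
      sqNorm ν μ D f + ENNReal.ofReal (‖c‖ ^ 2) * sqNorm ν μ D h) :
    thetaInner ν μ D f h = 0 := by
  have hρ : Continuous fun u : V => Real.exp (-ν * (herm u u).re) := by unfold herm; fun_prop
  have hint : ∀ k : V → ℂ, Continuous k → sqNorm ν μ D k < ∞ →
      Integrable (fun u => ‖k u‖ ^ 2 * Real.exp (-ν * (herm u u).re)) (μ.restrict D) ∧
      ∫ u in D, ‖k u‖ ^ 2 * Real.exp (-ν * (herm u u).re) ∂μ = (sqNorm ν μ D k).toReal := by
    intro k hk hk2
    have h0 : ∀ u, 0 ≤ ‖k u‖ ^ 2 * Real.exp (-ν * (herm u u).re) := fun u => by positivity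
    have hm : AEStronglyMeasurable (fun u => ‖k u‖ ^ 2 * Real.exp (-ν * (herm u u).re))
        (μ.restrict D) := ((hk.norm.pow 2).mul hρ).aestronglyMeasurable
    refine ⟨⟨hm, ?_⟩, integral_eq_lintegral_of_nonneg_ae (Filter.Eventually.of_forall h0) hm⟩
    rwa [hasFiniteIntegral_iff_ofReal (Filter.Eventually.of_forall h0)]
  obtain ⟨hf1, hf2⟩ := hint f hfc hf
  obtain ⟨hh1, hh2⟩ := hint h hhc hh
  have hI : Integrable (fun u => f u * conj (h u) * (Real.exp (-ν * (herm u u).re) : ℂ))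
      (μ.restrict D) := by
    refine (hf1.add hh1).mono' ((hfc.mul (Complex.continuous_conj.comp hhc)).mul
      (Complex.continuous_ofReal.comp hρ)).aestronglyMeasurable
      (Filter.Eventually.of_forall fun u => ?_)
    rw [norm_mul, norm_mul, RCLike.norm_conj, Complex.norm_real, Real.norm_of_nonneg
      (Real.exp_nonneg _), Pi.add_apply, ← add_mul]
    refine mul_le_mul_of_nonneg_right ?_ (Real.exp_nonneg _)
    nlinarith [sq_nonneg (‖f u‖ - ‖h u‖), norm_nonneg (f u), norm_nonneg (h u)]
  have key : ∀ c : ℂ, (conj c * thetaInner ν μ D f h).re = 0 := by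
    intro c
    have hc : sqNorm ν μ D (f + c • h) < ∞ := by
      rw [H]
      exact ENNReal.add_lt_top.2 ⟨hf, ENNReal.mul_lt_top ENNReal.ofReal_lt_top hh⟩
    obtain ⟨-, hc2⟩ := hint (f + c • h) (hfc.add (hhc.const_smul c)) hc
    have e1 : ∀ u, ‖(f + c • h) u‖ ^ 2 * Real.exp (-ν * (herm u u).re) =
        ‖f u‖ ^ 2 * Real.exp (-ν * (herm u u).re) +
        ‖c‖ ^ 2 * (‖h u‖ ^ 2 * Real.exp (-ν * (herm u u).re)) +
        2 * (conj c * (f u * conj (h u) * (Real.exp (-ν * (herm u u).re) : ℂ))).re := by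
      intro u
      have e2 : conj c * (f u * conj (h u) * (Real.exp (-ν * (herm u u).re) : ℂ)) =
          (f u * conj (c * h u)) * ((Real.exp (-ν * (herm u u).re) : ℝ) : ℂ) := by
        rw [map_mul]; ring
      rw [e2, Complex.re_mul_ofReal, Pi.add_apply, Pi.smul_apply, smul_eq_mul,
        ← Complex.normSq_eq_norm_sq, Complex.normSq_add, Complex.normSq_mul,
        Complex.normSq_eq_norm_sq, Complex.normSq_eq_norm_sq, Complex.normSq_eq_norm_sq]
      ring
    have hI2 : Integrable (fun u => (conj c * (f u * conj (h u) *
        (Real.exp (-ν * (herm u u).re) : ℂ))).re) (μ.restrict D) := (hI.const_mul (conj c)).re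
    have hI3 : ∫ u in D, (conj c * (f u * conj (h u) *
        (Real.exp (-ν * (herm u u).re) : ℂ))).re ∂μ = (conj c * thetaInner ν μ D f h).re := by
      rw [thetaInner, ← integral_const_mul]
      exact integral_re (hI.const_mul (conj c))
    have hA : Integrable (fun u => ‖f u‖ ^ 2 * Real.exp (-ν * (herm u u).re) +
        ‖c‖ ^ 2 * (‖h u‖ ^ 2 * Real.exp (-ν * (herm u u).re))) (μ.restrict D) :=
      hf1.add (hh1.const_mul _)
    simp only [e1] at hc2
    rw [integral_add hA (hI2.const_mul _),
      integral_add hf1 (hh1.const_mul _), integral_const_mul, integral_const_mul, hI3, hf2, hh2, H,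
      ENNReal.toReal_add hf.ne (ENNReal.mul_lt_top ENNReal.ofReal_lt_top hh).ne,
      ENNReal.toReal_mul, ENNReal.toReal_ofReal (sq_nonneg _)] at hc2
    linarith
  have k1 := key 1
  have k2 := key Complex.I
  rw [map_one, one_mul] at k1
  rw [Complex.conj_I, neg_mul, Complex.neg_re, Complex.I_mul_re, neg_neg] at k2
  exact Complex.ext k1 k2

section

variable {V : Type*} [NormedAddCommGroup V] [InnerProductSpace ℂ V] {Γ : AddSubgroup V}

theorem IsThetaEntire.add {ν : ℝ} {χ : Γ → ℂ} {f h : V → ℂ} (hf : IsThetaEntire ν Γ χ f)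
    (hh : IsThetaEntire ν Γ χ h) : IsThetaEntire ν Γ χ (f + h) :=
  ⟨hf.1.add hh.1, fun u γ => by rw [Pi.add_apply, Pi.add_apply, hf.2, hh.2, mul_add]⟩

theorem IsThetaEntire.const_smul {ν : ℝ} {χ : Γ → ℂ} {f : V → ℂ} (hf : IsThetaEntire ν Γ χ f)
    (c : ℂ) : IsThetaEntire ν Γ χ (c • f) :=
  ⟨hf.1.const_smul c, fun u γ => by
    rw [Pi.smul_apply, Pi.smul_apply, hf.2, smul_eq_mul, smul_eq_mul]; ring⟩

end

section

variable {V : Type*} [NormedAddCommGroup V] [InnerProductSpace ℂ V] [FiniteDimensional ℂ V]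
  {Γ : AddSubgroup V} [DiscreteTopology Γ] {r s : ℕ}

/-- On every ball, a series `∑ a_q e_q` with weighted square-summable coefficients is dominated by a
convergent numerical series. -/
theorem exists_summable_bound (hΓ : IsIsotropic Γ) (ω : Basis (Fin r) ℤ Γ)
    (η : OrthonormalBasis (Fin s) ℂ (cspan Γ)ᗮ) {ν : ℝ} (hν : 0 < ν) (α : Fin r → ℝ)
    {a : (Fin r → ℤ) × (Fin s → ℕ) → ℂ}
    (ha : Summable fun q => thetaWeight (gram ω) ν α q.1 q.2 * ‖a q‖ ^ 2) (R : ℝ) :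
    ∃ M : (Fin r → ℤ) × (Fin s → ℕ) → ℝ, Summable M ∧ ∀ q u, ‖u‖ ≤ R →
      ‖a q * thetaFun hΓ ω η ν α q.1 q.2 u‖ ≤ M q := by
  let L : V →L[ℂ] (Fin r → ℂ) × (Fin s → ℂ) := (coords hΓ ω η).toLinearMap.toContinuousLinearMap
  obtain ⟨G, hG⟩ := (isCompact_closedBall (0 : Fin r → ℂ) (‖L‖ * R)).exists_bound_of_continuousOn
    (differentiable_gaussFactor (B := gram ω) (ν := ν) (α := α)).continuous.continuousOn
  have hs := summable_bound_sq_div_thetaWeight (s := s) (gram_posDef ω) hν α (‖L‖ * R)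
  set m : (Fin r → ℤ) × (Fin s → ℕ) → ℝ := fun q =>
    (∏ j, Real.exp (2 * Real.pi * (‖L‖ * R) * |(q.1 j : ℝ)|)) * ∏ l, (‖L‖ * R) ^ q.2 l with hm
  refine ⟨fun q => thetaWeight (gram ω) ν α q.1 q.2 * ‖a q‖ ^ 2 +
    G ^ 2 * (m q ^ 2 / thetaWeight (gram ω) ν α q.1 q.2), ha.add (hs.mul_left _),
    fun q u hu => ?_⟩
  have hL : ‖coords hΓ ω η u‖ ≤ ‖L‖ * R :=
    (L.le_opNorm u).trans (mul_le_mul_of_nonneg_left hu (norm_nonneg _))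
  have h1 : ‖gaussFactor (gram ω) ν α (coords hΓ ω η u).1‖ ≤ G :=
    hG _ (mem_closedBall_zero_iff.2 ((norm_fst_le _).trans hL))
  have h2 : ‖expMonomial q (coords hΓ ω η u)‖ ≤ m q := norm_expMonomial_le q hL
  have hW := thetaWeight_pos (α := α) (gram_posDef ω) hν q.1 q.2
  set W := thetaWeight (gram ω) ν α q.1 q.2
  have h3 : ‖thetaFun hΓ ω η ν α q.1 q.2 u‖ ≤ G * m q := by
    rw [thetaFun_eq, norm_mul]
    exact mul_le_mul h1 h2 (norm_nonneg _) ((norm_nonneg _).trans h1)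
  rw [norm_mul]
  refine (mul_le_mul_of_nonneg_left h3 (norm_nonneg _)).trans ?_
  have h4 : W * ‖a q‖ ^ 2 + G ^ 2 * (m q ^ 2 / W) - 2 * (‖a q‖ * (G * m q)) =
      (W * ‖a q‖ - G * m q) ^ 2 / W := by
    field_simp
    ring
  have h5 : 0 ≤ (W * ‖a q‖ - G * m q) ^ 2 / W := by positivity
  have h6 : 0 ≤ ‖a q‖ * (G * m q) := mul_nonneg (norm_nonneg _) ((norm_nonneg _).trans h3)
  linarith

theorem isThetaEntire_of_hasSum (hΓ : IsIsotropic Γ) (ω : Basis (Fin r) ℤ Γ)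
    (η : OrthonormalBasis (Fin s) ℂ (cspan Γ)ᗮ) {ν : ℝ} (hν : 0 < ν) (α : Fin r → ℝ)
    {a : (Fin r → ℤ) × (Fin s → ℕ) → ℂ} {f : V → ℂ}
    (ha : Summable fun q => thetaWeight (gram ω) ν α q.1 q.2 * ‖a q‖ ^ 2)
    (hf : ∀ u, HasSum (fun q => a q * thetaFun hΓ ω η ν α q.1 q.2 u) (f u)) :
    IsThetaEntire ν Γ (thetaChar ω α) f := by
  refine ⟨differentiable_of_hasSum_of_bound
    (fun q => (isThetaEntire_thetaFun hΓ ω η ν α q).1.const_mul (a q))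
    (exists_summable_bound hΓ ω η hν α ha) hf, fun u γ => ?_⟩
  refine (hf (u + γ)).unique ?_
  convert! (hf u).mul_left (thetaChar ω α γ * Complex.exp (ν * herm (u + (1 / 2 : ℂ) • (γ : V))
    (γ : V))) using 2 with q
  rw [(isThetaEntire_thetaFun hΓ ω η ν α q).2]
  ring

theorem expCoeff_reduced_eq (hΓ : IsIsotropic Γ) (ω : Basis (Fin r) ℤ Γ)
    (η : OrthonormalBasis (Fin s) ℂ (cspan Γ)ᗮ) (ν : ℝ) (α : Fin r → ℝ)
    {a : (Fin r → ℤ) × (Fin s → ℕ) → ℂ} {f : V → ℂ}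
    (hf : ∀ u, HasSum (fun q => a q * thetaFun hΓ ω η ν α q.1 q.2 u) (f u)) :
    expCoeff (reduced ω η ν α f) = a := by
  refine expCoeff_eq_of_hasSum fun p => ?_
  have h := (hf (param ω η p)).mul_left (gaussFactor (gram ω) ν α p.1)⁻¹
  convert! h using 2
  rw [thetaFun_eq, coords_param]
  have := gaussFactor_ne_zero (B := gram ω) (ν := ν) (α := α) p.1
  field_simp

theorem summable_iff_tsum_lt_top {Q : Type*} {W : Q → ℝ} (hW : ∀ q, 0 ≤ W q) (a : Q → ℂ) :
    (Summable fun q => W q * ‖a q‖ ^ 2) ↔ ∑' q, ‖a q‖ₑ ^ 2 * ENNReal.ofReal (W q) < ∞ := by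
  have h0 : ∀ q, 0 ≤ W q * ‖a q‖ ^ 2 := fun q => mul_nonneg (hW q) (sq_nonneg _)
  have h : ∀ q, ‖a q‖ₑ ^ 2 * ENNReal.ofReal (W q) = ENNReal.ofReal (W q * ‖a q‖ ^ 2) := fun q => by
    rw [enorm_sq_eq_ofReal, ← ENNReal.ofReal_mul (sq_nonneg _), mul_comm]
  simp only [h]
  constructor
  · intro hs
    rw [← ENNReal.ofReal_tsum_of_nonneg h0 hs]
    exact ENNReal.ofReal_lt_top
  · intro hs
    have := ENNReal.summable_toReal hs.ne
    simpa only [ENNReal.toReal_ofReal (h0 _)] using this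

theorem dense_forall_ne_zero {ι κ : Type*} [Fintype ι] [Fintype κ] :
    Dense {p : (ι → ℂ) × (κ → ℂ) | ∀ l, p.2 l ≠ 0} := by
  have h : Dense {w : κ → ℂ | ∀ l, w l ≠ 0} := Measure.dense_of_ae ae_forall_ne_zero
  have h2 := (dense_univ (X := ι → ℂ)).prod h
  convert! h2 using 1
  ext p
  simp

/-- Entire functions with the theta automorphy factor whose coefficients are weighted square-summable
are the sum of their expansion. On the dense set where no coordinate of `z_⊥` vanishes this is the
pointwise convergence of Fourier series; the other points follow by continuity. -/
theorem hasSum_of_isThetaEntire (hΓ : IsIsotropic Γ) (ω : Basis (Fin r) ℤ Γ)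
    (η : OrthonormalBasis (Fin s) ℂ (cspan Γ)ᗮ) {ν : ℝ} (hν : 0 < ν) (α : Fin r → ℝ)
    {f : V → ℂ} (hf : IsThetaEntire ν Γ (thetaChar ω α) f)
    (hs : Summable fun q => thetaWeight (gram ω) ν α q.1 q.2 *
      ‖expCoeff (reduced ω η ν α f) q‖ ^ 2) (u : V) :
    HasSum (fun q => expCoeff (reduced ω η ν α f) q * thetaFun hΓ ω η ν α q.1 q.2 u) (f u) := by
  set a := expCoeff (reduced ω η ν α f) with ha
  have hsum : ∀ u, Summable fun q => a q * thetaFun hΓ ω η ν α q.1 q.2 u := by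
    intro u
    obtain ⟨M, hM, hb⟩ := exists_summable_bound hΓ ω η hν α hs ‖u‖
    exact Summable.of_norm_bounded hM fun q => hb q u le_rfl
  have hg : Continuous fun u => ∑' q, a q * thetaFun hΓ ω η ν α q.1 q.2 u :=
    (isThetaEntire_of_hasSum hΓ ω η hν α hs fun u => (hsum u).hasSum).1.continuous
  have hparam := (differentiable_param ω η).continuous
  have heq : (fun p => ∑' q, a q * thetaFun hΓ ω η ν α q.1 q.2 (param ω η p)) =
      fun p => f (param ω η p) := by
    refine Continuous.ext_on dense_forall_ne_zero (hg.comp hparam)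
      (hf.1.continuous.comp hparam) fun p hp => ?_
    have h0 := gaussFactor_ne_zero (B := gram ω) (ν := ν) (α := α) p.1
    have e : ∀ q, a q * thetaFun hΓ ω η ν α q.1 q.2 (param ω η p) =
        gaussFactor (gram ω) ν α p.1 * (a q * expMonomial q (p.1, p.2)) := by
      intro q
      rw [thetaFun_eq, coords_param]
      ring
    have h1 : Summable fun q => a q * expMonomial q (p.1, p.2) := by
      have := hsum (param ω η p)
      simp only [e] at this
      exact (summable_mul_left_iff h0).1 this
    have h2 := (hasSum_expCoeff (differentiable_reduced ω η hf.1) (reduced_add_intCast hΓ ω η hf)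
      hp h1).mul_left (gaussFactor (gram ω) ν α p.1)
    simp only [e]
    rw [h2.tsum_eq, reduced, mul_inv_cancel_left₀ h0]
  have h := congrFun heq (coords hΓ ω η u)
  simp only [param_coords] at h
  rw [← h]
  exact (hsum u).hasSum

theorem hasSum_finsetSum_thetaFun (hΓ : IsIsotropic Γ) (ω : Basis (Fin r) ℤ Γ)
    (η : OrthonormalBasis (Fin s) ℂ (cspan Γ)ᗮ) (ν : ℝ) (α : Fin r → ℝ)
    (a : (Fin r → ℤ) × (Fin s → ℕ) → ℂ) (S : Finset ((Fin r → ℤ) × (Fin s → ℕ))) (u : V) :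
    HasSum (fun q => (S : Set _).indicator a q * thetaFun hΓ ω η ν α q.1 q.2 u)
      ((∑ q ∈ S, a q • thetaFun hΓ ω η ν α q.1 q.2) u) := by
  rw [Finset.sum_apply]
  have h := hasSum_sum_of_ne_finset_zero (s := S) (L := SummationFilter.unconditional _)
    (f := fun q => (S : Set _).indicator a q * thetaFun hΓ ω η ν α q.1 q.2 u) fun q hq => by
      rw [Set.indicator_of_notMem (by simpa using hq), zero_mul]
  convert! h using 1
  refine Finset.sum_congr rfl fun q hq => ?_
  rw [Set.indicator_of_mem (by simpa using hq), Pi.smul_apply, smul_eq_mul]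

variable [MeasurableSpace V] [BorelSpace V]

theorem sqNorm_eq_tsum_of_hasSum (hΓ : IsIsotropic Γ) (ω : Basis (Fin r) ℤ Γ)
    (η : OrthonormalBasis (Fin s) ℂ (cspan Γ)ᗮ) {ν : ℝ} (hν : 0 < ν) {α : Fin r → ℝ} {D : Set V}
    (hD : IsAddFundamentalDomain Γ D (lebesgue ω η))
    {a : (Fin r → ℤ) × (Fin s → ℕ) → ℂ} {f : V → ℂ} (hf : IsThetaEntire ν Γ (thetaChar ω α) f)
    (hfa : ∀ u, HasSum (fun q => a q * thetaFun hΓ ω η ν α q.1 q.2 u) (f u)) :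
    sqNorm ν (lebesgue ω η) D f =
      ∑' q, ‖a q‖ₑ ^ 2 * ENNReal.ofReal (thetaWeight (gram ω) ν α q.1 q.2) := by
  rw [sqNorm_eq_tsum hΓ ω η hν hf hD, expCoeff_reduced_eq hΓ ω η ν α hfa]

/-- The norm of a linear combination of two distinct functions `e_q`, `e_{q'}`. -/
theorem sqNorm_thetaFun_add_smul (hΓ : IsIsotropic Γ) (ω : Basis (Fin r) ℤ Γ)
    (η : OrthonormalBasis (Fin s) ℂ (cspan Γ)ᗮ) {ν : ℝ} (hν : 0 < ν) (α : Fin r → ℝ) {D : Set V}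
    (hD : IsAddFundamentalDomain Γ D (lebesgue ω η)) {q q' : (Fin r → ℤ) × (Fin s → ℕ)}
    (hq : q ≠ q') (c : ℂ) :
    sqNorm ν (lebesgue ω η) D (thetaFun hΓ ω η ν α q.1 q.2 + c • thetaFun hΓ ω η ν α q'.1 q'.2) =
      ENNReal.ofReal (thetaWeight (gram ω) ν α q.1 q.2) +
        ENNReal.ofReal (‖c‖ ^ 2) * ENNReal.ofReal (thetaWeight (gram ω) ν α q'.1 q'.2) := by
  classical
  let a : (Fin r → ℤ) × (Fin s → ℕ) → ℂ := fun p => if p = q then 1 else c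
  have e : ∑ p ∈ {q, q'}, a p • thetaFun hΓ ω η ν α p.1 p.2 =
      thetaFun hΓ ω η ν α q.1 q.2 + c • thetaFun hΓ ω η ν α q'.1 q'.2 := by
    rw [Finset.sum_pair hq]
    simp [a, hq.symm]
  rw [← e, sqNorm_eq_tsum_of_hasSum hΓ ω η hν hD (by
      rw [e]
      exact (isThetaEntire_thetaFun hΓ ω η ν α q).add
        ((isThetaEntire_thetaFun hΓ ω η ν α q').const_smul c))
    (hasSum_finsetSum_thetaFun hΓ ω η ν α a {q, q'}),
    tsum_eq_sum (s := {q, q'}) (fun p hp => by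
      rw [Set.indicator_of_notMem (by simpa using hp)]; simp), Finset.sum_pair hq,
    Set.indicator_of_mem (by simp), Set.indicator_of_mem (by simp)]
  simp [a, hq.symm, ENNReal.ofReal_pow]

theorem sqNorm_thetaFun (hΓ : IsIsotropic Γ) (ω : Basis (Fin r) ℤ Γ)
    (η : OrthonormalBasis (Fin s) ℂ (cspan Γ)ᗮ) {ν : ℝ} (hν : 0 < ν) (α : Fin r → ℝ) {D : Set V}
    (hD : IsAddFundamentalDomain Γ D (lebesgue ω η)) (q : (Fin r → ℤ) × (Fin s → ℕ)) :
    sqNorm ν (lebesgue ω η) D (thetaFun hΓ ω η ν α q.1 q.2) =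
      ENNReal.ofReal (thetaWeight (gram ω) ν α q.1 q.2) := by
  classical
  have h := hasSum_finsetSum_thetaFun hΓ ω η ν α 1 {q}
  rw [Finset.sum_singleton, Pi.one_apply, one_smul] at h
  rw [sqNorm_eq_tsum_of_hasSum hΓ ω η hν hD (isThetaEntire_thetaFun hΓ ω η ν α q) h,
    tsum_eq_single q (fun p hp => by rw [Set.indicator_of_notMem (by simpa using hp)]; simp),
    Set.indicator_of_mem (by simp)]
  simp

theorem tendsto_sqNorm_sub_sum (hΓ : IsIsotropic Γ) (ω : Basis (Fin r) ℤ Γ)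
    (η : OrthonormalBasis (Fin s) ℂ (cspan Γ)ᗮ) {ν : ℝ} (hν : 0 < ν) (α : Fin r → ℝ) {D : Set V}
    (hD : IsAddFundamentalDomain Γ D (lebesgue ω η))
    {a : (Fin r → ℤ) × (Fin s → ℕ) → ℂ} {f : V → ℂ}
    (ha : Summable fun q => thetaWeight (gram ω) ν α q.1 q.2 * ‖a q‖ ^ 2)
    (hf : ∀ u, HasSum (fun q => a q * thetaFun hΓ ω η ν α q.1 q.2 u) (f u)) :
    Filter.Tendsto (fun S : Finset ((Fin r → ℤ) × (Fin s → ℕ)) => sqNorm ν (lebesgue ω η) D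
      (f - ∑ q ∈ S, a q • thetaFun hΓ ω η ν α q.1 q.2)) Filter.atTop (nhds 0) := by
  have hW : ∀ q : (Fin r → ℤ) × (Fin s → ℕ), 0 ≤ thetaWeight (gram ω) ν α q.1 q.2 :=
    fun q => (thetaWeight_pos (gram_posDef ω) hν _ _).le
  refine (ENNReal.tendsto_tsum_compl_atTop_zero
    ((summable_iff_tsum_lt_top hW a).1 ha).ne).congr fun S => ?_
  have h1 : ∀ u, HasSum (fun q => (S : Set _)ᶜ.indicator a q * thetaFun hΓ ω η ν α q.1 q.2 u)
      ((f - ∑ q ∈ S, a q • thetaFun hΓ ω η ν α q.1 q.2) u) := by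
    intro u
    have h := (hf u).sub (hasSum_finsetSum_thetaFun hΓ ω η ν α a S u)
    simpa only [← sub_mul, Set.indicator_compl, Pi.sub_apply] using h
  have h2 : Summable fun q => thetaWeight (gram ω) ν α q.1 q.2 *
      ‖(S : Set _)ᶜ.indicator a q‖ ^ 2 := by
    refine ha.of_nonneg_of_le (fun q => mul_nonneg (hW q) (sq_nonneg _)) fun q => ?_
    exact mul_le_mul_of_nonneg_left (pow_le_pow_left₀ (norm_nonneg _)
      (norm_indicator_le_norm_self _ _) 2) (hW q)
  rw [sqNorm_eq_tsum_of_hasSum hΓ ω η hν hD (isThetaEntire_of_hasSum hΓ ω η hν α h2 h1) h1]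
  refine (tsum_subtype ((S : Set _)ᶜ) fun q => ‖a q‖ₑ ^ 2 *
    ENNReal.ofReal (thetaWeight (gram ω) ν α q.1 q.2)).trans (tsum_congr fun q => ?_)
  by_cases hq : q ∈ ((S : Set _)ᶜ : Set ((Fin r → ℤ) × (Fin s → ℕ)))
  · rw [Set.indicator_of_mem hq, Set.indicator_of_mem hq]
  · rw [Set.indicator_of_notMem hq, Set.indicator_of_notMem hq]; simp

/-- The theta Fock–Bargmann space consists of the sums of the series `∑ a_q e_q` with weighted
square-summable coefficients. -/
theorem mem_space_iff_exists_hasSum (hΓ : IsIsotropic Γ) (ω : Basis (Fin r) ℤ Γ)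
    (η : OrthonormalBasis (Fin s) ℂ (cspan Γ)ᗮ) {ν : ℝ} (hν : 0 < ν) (α : Fin r → ℝ) {D : Set V}
    (hD : IsAddFundamentalDomain Γ D (lebesgue ω η)) (f : V → ℂ) :
    f ∈ space ν Γ (thetaChar ω α) (lebesgue ω η) D ↔
      ∃ a : (Fin r → ℤ) × (Fin s → ℕ) → ℂ,
        Summable (fun q => thetaWeight (gram ω) ν α q.1 q.2 * ‖a q‖ ^ 2) ∧
        ∀ u, HasSum (fun q => a q * thetaFun hΓ ω η ν α q.1 q.2 u) (f u) := by
  have hW : ∀ q : (Fin r → ℤ) × (Fin s → ℕ), 0 ≤ thetaWeight (gram ω) ν α q.1 q.2 :=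
    fun q => (thetaWeight_pos (gram_posDef ω) hν _ _).le
  constructor
  · rintro ⟨h1, h2, h3⟩
    have hf : IsThetaEntire ν Γ (thetaChar ω α) f := ⟨h1, h2⟩
    rw [sqNorm_eq_tsum hΓ ω η hν hf hD, ← summable_iff_tsum_lt_top hW] at h3
    exact ⟨_, h3, hasSum_of_isThetaEntire hΓ ω η hν α hf h3⟩
  · rintro ⟨a, ha, hfa⟩
    have hf := isThetaEntire_of_hasSum hΓ ω η hν α ha hfa
    refine ⟨hf.1, hf.2, ?_⟩
    rw [sqNorm_eq_tsum_of_hasSum hΓ ω η hν hD hf hfa]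
    exact (summable_iff_tsum_lt_top hW a).1 ha

end

end ThetaFB

theorem theorem1 {V : Type*} [NormedAddCommGroup V] [InnerProductSpace ℂ V]
    [FiniteDimensional ℂ V] [MeasurableSpace V] [BorelSpace V]
    (g r : ℕ) (hg : Module.finrank ℂ V = g)
    (ν : ℝ) (hν : 0 < ν)
    (Γ : AddSubgroup V) [DiscreteTopology Γ] (hΓ : ThetaFB.IsIsotropic Γ)
    (ω : Module.Basis (Fin r) ℤ Γ)
    (η : OrthonormalBasis (Fin (g - r)) ℂ (ThetaFB.cspan Γ)ᗮ)
    (α : Fin r → ℝ)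
    (D : Set V)
    (hD : MeasureTheory.IsAddFundamentalDomain Γ D (ThetaFB.lebesgue ω η)) :
    -- the functions lie in the space
    (∀ (n : Fin r → ℤ) (k : Fin (g - r) → ℕ), ThetaFB.thetaFun hΓ ω η ν α n k ∈
      ThetaFB.space ν Γ (ThetaFB.thetaChar ω α) (ThetaFB.lebesgue ω η) D) ∧
    -- they are pairwise orthogonal
    (∀ (n n' : Fin r → ℤ) (k k' : Fin (g - r) → ℕ), (n, k) ≠ (n', k') →
      ThetaFB.thetaInner ν (ThetaFB.lebesgue ω η) D
        (ThetaFB.thetaFun hΓ ω η ν α n k) (ThetaFB.thetaFun hΓ ω η ν α n' k') = 0) ∧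
    -- their linear span is dense in the space
    (∀ f ∈ ThetaFB.space ν Γ (ThetaFB.thetaChar ω α) (ThetaFB.lebesgue ω η) D,
      ∀ ε : ℝ≥0∞, 0 < ε →
        ∃ p ∈ Submodule.span ℂ (Set.range fun q : (Fin r → ℤ) × (Fin (g - r) → ℕ) =>
            ThetaFB.thetaFun hΓ ω η ν α q.1 q.2),
          ThetaFB.sqNorm ν (ThetaFB.lebesgue ω η) D (f - p) < ε) ∧
    -- their norms
    (∀ (n : Fin r → ℤ) (k : Fin (g - r) → ℕ),
      0 < ThetaFB.thetaWeight (ThetaFB.gram ω) ν α n k ∧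
      ThetaFB.sqNorm ν (ThetaFB.lebesgue ω η) D (ThetaFB.thetaFun hΓ ω η ν α n k) =
        ENNReal.ofReal (ThetaFB.thetaWeight (ThetaFB.gram ω) ν α n k)) ∧
    -- characterization of the space by series expansions
    (∀ f : V → ℂ,
      f ∈ ThetaFB.space ν Γ (ThetaFB.thetaChar ω α) (ThetaFB.lebesgue ω η) D ↔
      ∃ a : (Fin r → ℤ) × (Fin (g - r) → ℕ) → ℂ,
        Summable (fun q => ThetaFB.thetaWeight (ThetaFB.gram ω) ν α q.1 q.2 * ‖a q‖ ^ 2) ∧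
        ∀ u, HasSum (fun q => a q * ThetaFB.thetaFun hΓ ω η ν α q.1 q.2 u) (f u)) ∧
    -- such expansions also converge locally uniformly and in the norm of the space
    (∀ (f : V → ℂ) (a : (Fin r → ℤ) × (Fin (g - r) → ℕ) → ℂ),
      Summable (fun q => ThetaFB.thetaWeight (ThetaFB.gram ω) ν α q.1 q.2 * ‖a q‖ ^ 2) →
      (∀ u, HasSum (fun q => a q * ThetaFB.thetaFun hΓ ω η ν α q.1 q.2 u) (f u)) →
      HasSumLocallyUniformly (fun q u => a q * ThetaFB.thetaFun hΓ ω η ν α q.1 q.2 u) f ∧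
      Filter.Tendsto (fun S : Finset ((Fin r → ℤ) × (Fin (g - r) → ℕ)) =>
        ThetaFB.sqNorm ν (ThetaFB.lebesgue ω η) D
          (f - ∑ q ∈ S, a q • ThetaFB.thetaFun hΓ ω η ν α q.1 q.2))
        Filter.atTop (nhds 0)) := by
  open ThetaFB in
  refine ⟨fun n k => ⟨(isThetaEntire_thetaFun hΓ ω η ν α (n, k)).1,
    (isThetaEntire_thetaFun hΓ ω η ν α (n, k)).2, ?_⟩, fun n n' k k' hne => ?_, fun f hf ε hε => ?_,
    fun n k => ⟨thetaWeight_pos (gram_posDef ω) hν n k, sqNorm_thetaFun hΓ ω η hν α hD (n, k)⟩,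
    mem_space_iff_exists_hasSum hΓ ω η hν α hD, fun f a ha hf =>
      ⟨hasSumLocallyUniformly_of_bound (exists_summable_bound hΓ ω η hν α ha) hf,
        tendsto_sqNorm_sub_sum hΓ ω η hν α hD ha hf⟩⟩
  · rw [sqNorm_thetaFun hΓ ω η hν α hD (n, k)]
    exact ENNReal.ofReal_lt_top
  · have h := sqNorm_thetaFun hΓ ω η hν α hD (n, k)
    have h' := sqNorm_thetaFun hΓ ω η hν α hD (n', k')
    refine thetaInner_eq_zero_of_sqNorm_add (isThetaEntire_thetaFun hΓ ω η ν α (n, k)).1.continuous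
      (isThetaEntire_thetaFun hΓ ω η ν α (n', k')).1.continuous (h ▸ ENNReal.ofReal_lt_top)
      (h' ▸ ENNReal.ofReal_lt_top) fun c => ?_
    rw [h, h']
    exact sqNorm_thetaFun_add_smul hΓ ω η hν α hD hne c
  · obtain ⟨a, ha, hfa⟩ := (mem_space_iff_exists_hasSum hΓ ω η hν α hD f).1 hf
    obtain ⟨S, hS⟩ := ((tendsto_sqNorm_sub_sum hΓ ω η hν α hD ha hfa).eventually
      (gt_mem_nhds hε)).exists
    exact ⟨_, Submodule.sum_mem _ fun q _ =>
      Submodule.smul_mem _ _ (Submodule.subset_span ⟨q, rfl⟩), hS⟩
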